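/- Let $\mathfrak C=\{0,1\}^{\mathbf N}$ be the Cantor space, and for a finite word $m$ in the letters $0,1$ let $m\cdot\mathfrak C$ be the set of all sequences with prefix $m$ (a standard dyadic interval). A standard dyadic partition is a finite partition of $\mathfrak C$ into standard dyadic intervals. Thompson's group $V$ is the group of all homeomorphisms $v$ of $\mathfrak C$ for which there are two standard dyadic partitions $(m_k\cdot\mathfrak C)_{1\le k\le n}$ and $(w_k\cdot\mathfrak C)_{1\le k\le n}$ with $v(m_k\cdot z)=w_k\cdot z$ for all $1\le k\le n$ and $z\in\mathfrak C$. For a group $\Gamma$ let $L\Gamma$ be the group, under pointwise multiplication, of all locally constant maps $\mathfrak C\to\Gamma$. Given $\alpha_0,\alpha_1\in\mathrm{Aut}(\Gamma)$, put $\alpha_m:=\alpha_{l_n}\circ\cdots\circ\alpha_{l_1}$ for a word $m=l_1\cdots l_n$. For $v\in V$ and $x\in\mathfrak C$ put $\tau_{v,x}:=\alpha_w^{-1}\circ\alpha_m$, where $m$ is any prefix of $x$ for which there is a word $w$ with $v(m\cdot z)=w\cdot z$ for all $z\in\mathfrak C$ (this does not depend on the choice of $m$). The formula $\pi_v(a)(vx)=\tau_{v,x}(a(x))$,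 for $v\in V$, $a\in L\Gamma$, $x\in\mathfrak C$, defines an action of $V$ on $L\Gamma$ by automorphisms. The resulting semidirect product $G(\Gamma,\alpha_0,\alpha_1):=L\Gamma\rtimes V$ is the fraction group of the triple $(\Gamma,\alpha_0,\alpha_1)$. **Theorem A.** Let $\Gamma,\tilde\Gamma$ be groups, $\alpha_0,\alpha_1\in\mathrm{Aut}(\Gamma)$ and $\tilde\alpha_0,\tilde\alpha_1\in\mathrm{Aut}(\tilde\Gamma)$. Put $G=G(\Gamma,\alpha_0,\alpha_1)$ and $\tilde G=G(\tilde\Gamma,\tilde\alpha_0,\tilde\alpha_1)$. 1. If $G\simeq\tilde G$, then $\Gamma\simeq\tilde\Gamma$. 2. If $\tilde\alpha_0$ and $\tilde\alpha_1$ are inner automorphisms, then $G\simeq\tilde G$ if and only if $\Gamma\simeq\tilde\Gamma$ and both $\alpha_0$ and $\alpha_1$ are inner automorphisms. 3. In particular, the untwisted fraction groups satisfy $G(\Gamma,\mathrm{id}_\Gamma,\mathrm{id}_\Gamma)\simeq G(\tilde\Gamma,\mathrm{id}_{\tilde\Gamma},\mathrm{id}_{\tilde\Gamma})$ if and only if $\Gamma\simeq\tilde\Gamma$.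 -/

import Mathlib

namespace DiscreteLoop

/-- The Cantor space `{0,1}^ℕ` with the product topology (`false` is the letter `0`, `true` is `1`). -/
abbrev Cantor : Type := ℕ → Bool

/-- The concatenation `m · x` of a finite word `m` and an infinite sequence `x`. -/
def app : List Bool → Cantor → Cantor
  | [], x => x
  | b :: m, x => fun n => Nat.casesOn n b (app m x)

/-- The standard dyadic interval of all sequences with prefix `m`. -/
def sdi (m : List Bool) : Set Cantor := Set.range (app m)

/-- `p` lists the words of a standard dyadic partition: each point of the Cantor space
lies in exactly one of the standard dyadic intervals `sdi (p k)`. -/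
def IsSDP {n : ℕ} (p : Fin n → List Bool) : Prop := ∀ x : Cantor, ∃! k, x ∈ sdi (p k)

/-- `v` carries the sequences with prefix `m` to those with prefix `w` by exchanging prefixes. -/
def Adapted (v : Cantor ≃ₜ Cantor) (m w : List Bool) : Prop := ∀ z, v (app m z) = app w z

/-- `v` maps a standard dyadic partition onto another one by exchanging prefixes. -/
def IsThompson (v : Cantor ≃ₜ Cantor) : Prop :=
  ∃ (n : ℕ) (p q : Fin n → List Bool), IsSDP p ∧ IsSDP q ∧ ∀ k, Adapted v (p k) (q k)

/-! ### Words and prefixes -/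

lemma app_append (m w : List Bool) (x : Cantor) : app (m ++ w) x = app m (app w x) := by
  induction m with
  | nil => rfl
  | cons b m ih => simp [app, ih]

lemma app_cons_inj {b c : Bool} {m w : List Bool} {x y : Cantor}
    (h : app (b :: m) x = app (c :: w) y) : b = c ∧ app m x = app w y :=
  ⟨congrFun h 0, funext fun n => congrFun h (n + 1)⟩

lemma app_injective (m : List Bool) : Function.Injective (app m) := by
  induction m with
  | nil => exact fun _ _ h => h
  | cons b m ih => exact fun _ _ h => ih (app_cons_inj h).2

lemma exists_word (N : ℕ) (x : Cantor) : ∃ m : List Bool, m.length = N ∧ ∃ z, x = app m z := by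
  induction N generalizing x with
  | zero => exact ⟨[], rfl, x, rfl⟩
  | succ N ih =>
    obtain ⟨m, hm, z, hz⟩ := ih fun n => x (n + 1)
    refine ⟨x 0 :: m, by simp [hm], z, funext fun n => ?_⟩
    cases n with
    | zero => rfl
    | succ n => exact congrFun hz n

lemma prefix_of_app_eq {m w : List Bool} {x y : Cantor} (h : app m x = app w y)
    (hl : m.length ≤ w.length) : ∃ r, w = m ++ r ∧ x = app r y := by
  induction m generalizing w with
  | nil => exact ⟨w, rfl, h⟩
  | cons b m ih =>
    cases w with
    | nil => simp at hl
    | cons c w =>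
      obtain ⟨hb, h'⟩ := app_cons_inj h
      obtain ⟨r, hr, hx⟩ := ih h' (by simpa using hl)
      exact ⟨r, by simp [hb, hr], hx⟩

lemma eq_of_app_eq {m w : List Bool} (h : ∀ z, app m z = app w z) : m = w := by
  induction m generalizing w with
  | nil =>
    cases w with
    | nil => rfl
    | cons c w => simpa [app] using congrFun (h fun _ => !c) 0
  | cons b m ih =>
    cases w with
    | nil => simpa [app] using congrFun (h fun _ => !b) 0
    | cons c w =>
      rw [(app_cons_inj (h fun _ => false)).1, ih fun z => (app_cons_inj (h z)).2]

lemma isOpen_sdi (m : List Bool) : IsOpen (sdi m) := by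
  induction m with
  | nil =>
    have : sdi [] = Set.univ := Set.eq_univ_of_forall fun x => ⟨x, rfl⟩
    rw [this]; exact isOpen_univ
  | cons b m ih =>
    have : sdi (b :: m) = (fun x : Cantor => x 0) ⁻¹' {b} ∩
        (fun (x : Cantor) (n : ℕ) => x (n + 1)) ⁻¹' sdi m := by
      ext x
      constructor
      · rintro ⟨z, rfl⟩
        exact ⟨rfl, z, rfl⟩
      · rintro ⟨h0, z, hz⟩
        refine ⟨z, funext fun n => ?_⟩
        cases n with
        | zero => exact h0.symm
        | succ n => exact congrFun hz n
    rw [this]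
    exact ((isOpen_discrete _).preimage (continuous_apply 0)).inter
      (ih.preimage (continuous_pi fun n => continuous_apply (n + 1)))

/-! ### Thompson's group `V` -/

lemma isThompson_of_level {v : Cantor ≃ₜ Cantor} (N : ℕ)
    (h : ∀ m : List Bool, m.length = N → ∃ w, Adapted v m w) : IsThompson v := by
  classical
  let e := Fintype.equivFin (List.Vector Bool N)
  let p : Fin (Fintype.card (List.Vector Bool N)) → List Bool := fun k => (e.symm k).1
  have hp : IsSDP p := by
    intro x
    obtain ⟨m, hm, z, rfl⟩ := exists_word N x
    let c : List.Vector Bool N := ⟨m, hm⟩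
    have hc : p (e c) = m := congrArg Subtype.val (e.symm_apply_apply c)
    refine ⟨e c, ⟨z, by rw [hc]⟩, ?_⟩
    rintro k ⟨y, hy⟩
    obtain ⟨r, hr, -⟩ := prefix_of_app_eq hy (by simp [p, hm, (e.symm k).2])
    have hlen := congrArg List.length hr
    have hk : (p k).length = N := (e.symm k).2
    have hr0 : r = [] := by
      rw [List.length_append, hm, hk] at hlen
      exact List.length_eq_zero_iff.1 (by omega)
    have hk' : e.symm k = c := Subtype.ext (by simpa [hr0] using hr.symm)
    exact (Equiv.symm_apply_eq e).1 hk'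
  choose q hq using fun k => h (p k) (e.symm k).2
  refine ⟨_, p, q, hp, fun x => ?_, hq⟩
  have key : ∀ k, x ∈ sdi (q k) ↔ v.symm x ∈ sdi (p k) := fun k =>
    ⟨fun ⟨z, hz⟩ => ⟨z, by rw [← hz, ← hq k z, v.symm_apply_apply]⟩,
      fun ⟨z, hz⟩ => ⟨z, by rw [← hq k z, hz, v.apply_symm_apply]⟩⟩
  simpa only [key] using hp (v.symm x)

lemma IsThompson.level {v : Cantor ≃ₜ Cantor} (hv : IsThompson v) :
    ∃ N : ℕ, ∀ m : List Bool, N ≤ m.length → ∃ w, Adapted v m w := by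
  obtain ⟨n, p, q, hp, -, h⟩ := hv
  refine ⟨Finset.univ.sup fun k => (p k).length, fun m hm => ?_⟩
  obtain ⟨k, ⟨y, hy⟩, -⟩ := hp (app m fun _ => false)
  obtain ⟨r, rfl, -⟩ := prefix_of_app_eq hy
    ((Finset.le_sup (f := fun k => (p k).length) (Finset.mem_univ k)).trans hm)
  exact ⟨q k ++ r, fun z => by rw [app_append, app_append, h k]⟩

/-- Thompson's group `V`, as a group of homeomorphisms of the Cantor space. -/
def thompsonV : Subgroup (Cantor ≃ₜ Cantor) where
  carrier := {v | IsThompson v}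
  one_mem' := isThompson_of_level 0 fun m _ => ⟨m, fun _ => rfl⟩
  mul_mem' := by
    rintro w v hw hv
    obtain ⟨N, hN⟩ := IsThompson.level hv
    obtain ⟨M, hM⟩ := IsThompson.level hw
    refine isThompson_of_level (N + M) fun m hm => ?_
    obtain ⟨u, hu⟩ := hN (m.take N) (by simp [hm])
    obtain ⟨t, ht⟩ := hM (u ++ m.drop N) (by simp [hm])
    refine ⟨t, fun z => ?_⟩
    rw [← ht z, app_append, ← hu, ← app_append, List.take_append_drop]
    rfl
  inv_mem' := by
    rintro v ⟨n, p, q, hp, hq, h⟩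
    refine ⟨n, q, p, hq, hp, fun k z => ?_⟩
    rw [← h k z]
    exact v.symm_apply_apply _

/-- Every point has a prefix `m` on which `v ∈ V` acts by exchanging `m` for a word `w`. -/
lemma exists_adapted (v : thompsonV) (x : Cantor) :
    ∃ mw : List Bool × List Bool, x ∈ sdi mw.1 ∧ Adapted v.1 mw.1 mw.2 := by
  obtain ⟨n, p, q, hp, -, h⟩ := v.2
  obtain ⟨k, hk, -⟩ := hp x
  exact ⟨(p k, q k), hk, h k⟩

/-! ### The twisted action of `V` on the discrete loop group -/

section Action

variable {Γ : Type*} [Group Γ]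

/-- `α_m = α_{l_n} ∘ ⋯ ∘ α_{l_1}` for a word `m = l_1 ⋯ l_n`. -/
def wordAut (α₀ α₁ : MulAut Γ) : List Bool → MulAut Γ
  | [] => 1
  | b :: m => wordAut α₀ α₁ m * bif b then α₁ else α₀

lemma wordAut_append (α₀ α₁ : MulAut Γ) (m w : List Bool) :
    wordAut α₀ α₁ (m ++ w) = wordAut α₀ α₁ w * wordAut α₀ α₁ m := by
  induction m with
  | nil => simp [wordAut]
  | cons b m ih => simp [wordAut, ih, mul_assoc]

/-- The twist `τ_{v,x} = α_w⁻¹ ∘ α_m`, where `m` is a prefix of `x` and `v` exchanges the prefix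
`m` for `w`; by `tau_eq` this does not depend on the choice of `m` and `w`. -/
noncomputable def tau (α₀ α₁ : MulAut Γ) (v : thompsonV) (x : Cantor) : MulAut Γ :=
  (wordAut α₀ α₁ (exists_adapted v x).choose.2)⁻¹ *
    wordAut α₀ α₁ (exists_adapted v x).choose.1

lemma tau_indep (α₀ α₁ : MulAut Γ) (v : Cantor ≃ₜ Cantor) {x : Cantor} {m w m' w' : List Bool}
    (hx : x ∈ sdi m) (h : Adapted v m w) (hx' : x ∈ sdi m') (h' : Adapted v m' w')
    (hl : m.length ≤ m'.length) :
    (wordAut α₀ α₁ w')⁻¹ * wordAut α₀ α₁ m' = (wordAut α₀ α₁ w)⁻¹ * wordAut α₀ α₁ m := by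
  obtain ⟨z, rfl⟩ := hx
  obtain ⟨z', hz'⟩ := hx'
  obtain ⟨r, rfl, -⟩ := prefix_of_app_eq hz'.symm hl
  have hw : w' = w ++ r := eq_of_app_eq fun y => by
    rw [← h' y, app_append, app_append, h]
  rw [hw, wordAut_append, wordAut_append]
  group

lemma tau_eq (α₀ α₁ : MulAut Γ) (v : thompsonV) {x : Cantor} {m w : List Bool}
    (hx : x ∈ sdi m) (h : Adapted v.1 m w) :
    tau α₀ α₁ v x = (wordAut α₀ α₁ w)⁻¹ * wordAut α₀ α₁ m := by
  have hc := (exists_adapted v x).choose_spec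
  rcases le_total m.length (exists_adapted v x).choose.1.length with hl | hl
  · exact tau_indep α₀ α₁ v.1 hx h hc.1 hc.2 hl
  · exact (tau_indep α₀ α₁ v.1 hc.1 hc.2 hx h hl).symm

lemma tau_one (α₀ α₁ : MulAut Γ) (x : Cantor) : tau α₀ α₁ 1 x = 1 := by
  have hx : x ∈ sdi [] := ⟨x, rfl⟩
  rw [tau_eq α₀ α₁ 1 (w := []) hx fun _ => rfl, inv_mul_cancel]

lemma tau_mul (α₀ α₁ : MulAut Γ) (w v : thompsonV) (x : Cantor) :
    tau α₀ α₁ (w * v) x = tau α₀ α₁ w (v.1 x) * tau α₀ α₁ v x := by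
  obtain ⟨⟨m, u⟩, ⟨z, hz⟩, hv⟩ := exists_adapted v x
  obtain ⟨N, hN⟩ := IsThompson.level w.2
  obtain ⟨r, hr, y, rfl⟩ := exists_word N z
  obtain ⟨t, ht⟩ := hN (u ++ r) (by simp [hr])
  have hx : x ∈ sdi (m ++ r) := ⟨y, by rw [app_append]; exact hz⟩
  have hv' : Adapted v.1 (m ++ r) (u ++ r) := fun a => by
    rw [app_append, app_append]; exact hv _
  have hvx : v.1 x ∈ sdi (u ++ r) := by
    obtain ⟨a, rfl⟩ := hx
    exact ⟨a, (hv' a).symm⟩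
  have hwv : Adapted (w * v).1 (m ++ r) t := fun a => by
    rw [← ht a, ← hv' a]; rfl
  rw [tau_eq α₀ α₁ _ hx hwv, tau_eq α₀ α₁ _ hvx ht, tau_eq α₀ α₁ _ hx hv']
  group

lemma isLocallyConstant_tau (α₀ α₁ : MulAut Γ) (v : thompsonV) :
    IsLocallyConstant (tau α₀ α₁ v) := by
  rw [IsLocallyConstant.iff_exists_open]
  intro x
  obtain ⟨⟨m, w⟩, hx, h⟩ := exists_adapted v x
  exact ⟨sdi m, isOpen_sdi m, hx, fun y hy => by
    rw [tau_eq α₀ α₁ v hy h, tau_eq α₀ α₁ v hx h]⟩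

variable (Γ) in
/-- The discrete loop group `LΓ`: locally constant maps from the Cantor space to `Γ`, with
pointwise multiplication. -/
abbrev LoopGroup : Type _ := LocallyConstant Cantor Γ

/-- `π_v(a)(y) = τ_{v,x}(a(x))` with `x = v⁻¹ y`. -/
noncomputable def act (α₀ α₁ : MulAut Γ) (v : thompsonV) (a : LoopGroup Γ) : LoopGroup Γ where
  toFun y := tau α₀ α₁ v (v.1.symm y) (a (v.1.symm y))
  isLocallyConstant :=
    ((isLocallyConstant_tau α₀ α₁ v).comp₂ a.isLocallyConstant fun t g => t g).comp_continuous
      v.1.symm.continuous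

lemma act_apply (α₀ α₁ : MulAut Γ) (v : thompsonV) (a : LoopGroup Γ) (x : Cantor) :
    act α₀ α₁ v a (v.1 x) = tau α₀ α₁ v x (a x) := by
  change tau α₀ α₁ v (v.1.symm (v.1 x)) (a (v.1.symm (v.1 x))) = _
  rw [v.1.symm_apply_apply]

lemma act_one (α₀ α₁ : MulAut Γ) (a : LoopGroup Γ) : act α₀ α₁ 1 a = a := by
  ext x
  have h := act_apply α₀ α₁ 1 a x
  rw [tau_one] at h
  exact h

lemma act_mul (α₀ α₁ : MulAut Γ) (w v : thompsonV) (a : LoopGroup Γ) :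
    act α₀ α₁ (w * v) a = act α₀ α₁ w (act α₀ α₁ v a) := by
  ext y
  obtain ⟨x, rfl⟩ := (w * v).1.surjective y
  rw [act_apply, tau_mul]
  change _ = act α₀ α₁ w (act α₀ α₁ v a) (w.1 (v.1 x))
  rw [act_apply, act_apply]
  rfl

/-- The twisted (Jones) action `π : V → Aut(LΓ)`, `π_v(a)(v x) = τ_{v,x}(a(x))`. -/
noncomputable def jonesAction (α₀ α₁ : MulAut Γ) : thompsonV →* MulAut (LoopGroup Γ) where
  toFun v :=
    { toFun := act α₀ α₁ v
      invFun := act α₀ α₁ v⁻¹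
      left_inv := fun a => by rw [← act_mul, inv_mul_cancel, act_one]
      right_inv := fun a => by rw [← act_mul, mul_inv_cancel, act_one]
      map_mul' := fun a b => by
        ext y
        exact map_mul (tau α₀ α₁ v (v.1.symm y)) _ _ }
  map_one' := by
    ext1 a
    exact act_one α₀ α₁ a
  map_mul' w v := by
    ext1 a
    exact act_mul α₀ α₁ w v a

/-- The fraction group `LΓ ⋊ V` of the triple `(Γ, α₀, α₁)`. -/
abbrev FractionGroup (α₀ α₁ : MulAut Γ) : Type _ :=
  LoopGroup Γ ⋊[jonesAction α₀ α₁] thompsonV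

/-- `α` is an inner automorphism, i.e. conjugation `h ↦ g h g⁻¹` by some `g`. -/
def IsInner (α : MulAut Γ) : Prop := ∃ g : Γ, α = MulAut.conj g

end Action

end DiscreteLoop

/-! An isomorphism θ of fraction groups turns out to respect loops, `V` and the Cantor space, so it
can be read off at a single point.

Loops go to loops (`right_map_inl`): the image of LΓ in `V` is normal and contains two commuting
subgroups that it normalises, the images of the loops on the two halves. `V` has enough elements of
small support to force one of them to be trivial (`LocallyMoving.eq_bot_or_eq_bot`), and elements of
`V` carry either half onto the other, so both are. Hence θ induces an automorphism of `V` and an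
isomorphism of loop groups. By a reconstruction in the style of Rubin, inclusion of supports is
expressible in group terms (`LocallyMoving.supportedIn_iff`), so the automorphism of `V` is
conjugation by a homeomorphism (`exists_homeomorph_of_mulEquiv`). Pulling back along it gives a
`LoopIso`, equivariant up to a cocycle.

A loop supported on an interval away from x may still affect the value of the image at x, but only
by a central element; these contributions form the homomorphism `outer`. Dividing them out of the
values of constant loops gives `localHom`, which is computed on any interval around x, is bijective,
and intertwines τ with the cocycle. This proves Γ ≃ Γ̃. If the target twists are inner, so is the
cocycle; at a fixed point of an element of `V` with τ = α_b⁻¹, the intertwining relation makes α_b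
inner. Conversely, inner twists are removed by multiplying by the cocycle g_w⁻¹ g_m (`untwist`). -/

namespace DiscreteLoop

open Topology SemidirectProduct
open scoped commutatorElement

/-! ### Supports of group elements -/

section Support

variable {G X : Type*} [Group G] [MulAction G X]

/-- `g` fixes every point outside `U`. -/
def SupportedIn (g : G) (U : Set X) : Prop := ∀ x ∉ U, g • x = x

lemma SupportedIn.mono {g : G} {U W : Set X} (h : SupportedIn g U) (hUW : U ⊆ W) :
    SupportedIn g W := fun x hx => h x fun hxU => hx (hUW hxU)

lemma SupportedIn.inv {g : G} {U : Set X} (h : SupportedIn g U) : SupportedIn g⁻¹ U :=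
  fun x hx => inv_smul_eq_iff.2 (h x hx).symm

lemma SupportedIn.mul {f g : G} {U : Set X} (hf : SupportedIn f U) (hg : SupportedIn g U) :
    SupportedIn (f * g) U := fun x hx => by rw [mul_smul, hg x hx, hf x hx]

lemma SupportedIn.pow {g : G} {U : Set X} (h : SupportedIn g U) (n : ℕ) :
    SupportedIn (g ^ n) U := by
  induction n with
  | zero => exact fun x _ => by simp
  | succ n ih => rw [pow_succ]; exact ih.mul h

lemma SupportedIn.commutator {f g : G} {U : Set X} (hf : SupportedIn f U)
    (hg : SupportedIn g U) : SupportedIn ⁅f, g⁆ U :=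
  ((hf.mul hg).mul hf.inv).mul hg.inv

lemma SupportedIn.conj {g : G} {U W : Set X} (h : SupportedIn g U) (f : G)
    (hW : ∀ x ∈ U, f • x ∈ W) : SupportedIn (f * g * f⁻¹) W := fun x hx => by
  have : f⁻¹ • x ∉ U := fun hU => hx (by simpa using hW _ hU)
  rw [mul_smul, mul_smul, h _ this, smul_inv_smul]

lemma SupportedIn.smul_mem {g : G} {U : Set X} (h : SupportedIn g U) {x : X} (hx : x ∈ U) :
    g • x ∈ U := by
  by_contra hgx
  exact hgx ((smul_left_cancel g (h _ hgx)).symm ▸ hx)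

lemma SupportedIn.mem_of_ne {g : G} {U : Set X} (h : SupportedIn g U) {x : X}
    (hx : g • x ≠ x) : x ∈ U := by
  by_contra hU
  exact hx (h x hU)

variable [FaithfulSMul G X]

lemma exists_smul_ne {g : G} (hg : g ≠ 1) : ∃ x : X, g • x ≠ x := by
  by_contra! h
  exact hg (FaithfulSMul.eq_of_smul_eq_smul fun x : X => by rw [h x, one_smul])

lemma SupportedIn.commute {f g : G} {U : Set X} (hf : SupportedIn f U)
    (hg : SupportedIn g Uᶜ) : Commute f g := by
  refine FaithfulSMul.eq_of_smul_eq_smul fun x : X => ?_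
  rw [mul_smul, mul_smul]
  by_cases hx : x ∈ U
  · rw [hg x (by simpa using hx), hg _ (by simpa using hf.smul_mem hx)]
  · rw [hf x hx, hf _ (hg.smul_mem hx)]

/-- A point x of `U` has its image `f • x` outside `U`, where `d` is trivial; commuting with `f`
carries this triviality back to x. -/
lemma SupportedIn.eq_one_of_commute {d f : G} {U : Set X} (hd : SupportedIn d U)
    (hf : ∀ x ∈ U, f • x ∉ U) (h : Commute d f) : d = 1 := by
  refine FaithfulSMul.eq_of_smul_eq_smul fun x : X => ?_
  rw [one_smul]
  by_cases hx : x ∈ U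
  · have h1 : d • f • x = f • d • x := by rw [← mul_smul, ← mul_smul, h.eq]
    rw [hd _ (hf x hx)] at h1
    exact (smul_left_cancel f h1).symm
  · exact hd x hx

/-- If `f` moves `U` off itself, the commutator of elements supported in `U` is a double
commutator involving `f`. -/
lemma commutator_commutator_of_displaced {a b f : G} {U : Set X} (ha : SupportedIn a U)
    (hb : SupportedIn b U) (hf : ∀ x ∈ U, f • x ∉ U) : ⁅⁅a, f⁆, b⁆ = ⁅a, b⁆ := by
  have hc : SupportedIn (f * a⁻¹ * f⁻¹) Uᶜ := ha.inv.conj f hf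
  have hcb : Commute (f * a⁻¹ * f⁻¹) b := (hb.commute hc).symm
  have : ⁅a, f⁆ = a * (f * a⁻¹ * f⁻¹) := by simp [commutatorElement_def, mul_assoc]
  rw [this, commutatorElement_def, commutatorElement_def, mul_inv_rev]
  calc a * (f * a⁻¹ * f⁻¹) * b * ((f * a⁻¹ * f⁻¹)⁻¹ * a⁻¹) * b⁻¹
      = a * ((f * a⁻¹ * f⁻¹) * b) * ((f * a⁻¹ * f⁻¹)⁻¹ * a⁻¹) * b⁻¹ := by group
    _ = a * (b * (f * a⁻¹ * f⁻¹)) * ((f * a⁻¹ * f⁻¹)⁻¹ * a⁻¹) * b⁻¹ := by rw [hcb.eq]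
    _ = a * b * a⁻¹ * b⁻¹ := by group

end Support

/-! ### Locally moving actions -/

/-- Every nonempty open set supports an element whose twelfth power is nontrivial. -/
def LocallyMoving (G X : Type*) [Group G] [TopologicalSpace X] [MulAction G X] : Prop :=
  ∀ U : Set X, IsOpen U → U.Nonempty → ∃ g : G, SupportedIn g U ∧ g ^ 12 ≠ 1

lemma LocallyMoving.exists_ne_one {G X : Type*} [Group G] [TopologicalSpace X]
    [MulAction G X] (hG : LocallyMoving G X) {U : Set X} (hU : IsOpen U)
    (hne : U.Nonempty) : ∃ g : G, SupportedIn g U ∧ g ≠ 1 := by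
  obtain ⟨g, hg, h1⟩ := hG U hU hne
  exact ⟨g, hg, fun h => h1 (by rw [h, one_pow])⟩

section LocallyMoving

variable {G X : Type*} [Group G] [TopologicalSpace X] [T2Space X] [MulAction G X]
  [ContinuousConstSMul G X]

lemma exists_displaced {f : G} {x : X} (hf : f • x ≠ x) {W : Set X} (hW : W ∈ 𝓝 x) :
    ∃ U : Set X, IsOpen U ∧ x ∈ U ∧ U ⊆ W ∧ ∀ y ∈ U, f • y ∉ U := by
  obtain ⟨A, B, hA, hB, hfA, hxB, hAB⟩ := t2_separation hf
  refine ⟨interior W ∩ ((f • ·) ⁻¹' A ∩ B), isOpen_interior.inter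
    ((hA.preimage (continuous_const_smul f)).inter hB),
    ⟨mem_interior_iff_mem_nhds.2 hW, hfA, hxB⟩,
    fun y hy => interior_subset hy.1, fun y hy hfy => ?_⟩
  exact Set.disjoint_left.1 hAB hy.2.1 hfy.2.2

variable [FaithfulSMul G X]

lemma LocallyMoving.exists_commutator_ne_one (hG : LocallyMoving G X) {U : Set X}
    (hU : IsOpen U) (hne : U.Nonempty) :
    ∃ a b : G, SupportedIn a U ∧ SupportedIn b U ∧ ⁅a, b⁆ ≠ 1 := by
  obtain ⟨a, ha, ha1⟩ := hG.exists_ne_one hU hne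
  obtain ⟨x, hx⟩ := exists_smul_ne (X := X) ha1
  obtain ⟨W, hW, hxW, hWU, haW⟩ := exists_displaced hx (hU.mem_nhds (ha.mem_of_ne hx))
  obtain ⟨b, hb, hb1⟩ := hG.exists_ne_one hW ⟨x, hxW⟩
  refine ⟨a, b, ha, hb.mono hWU, fun h => hb1 (hb.eq_one_of_commute haW ?_)⟩
  exact (commutatorElement_eq_one_iff_commute.1 h).symm

/-- Two commuting subgroups which are normalised by a normal subgroup containing them
cannot both be nontrivial. -/
theorem LocallyMoving.eq_bot_or_eq_bot (hG : LocallyMoving G X) (hX : ∀ x y : X, x ≠ y →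
      ∀ A ∈ 𝓝 x, ∀ B ∈ 𝓝 y, ∃ (U : Set X) (g : G), IsOpen U ∧ x ∈ U ∧ U ⊆ A ∧
        (∀ z ∈ U, g • z ∈ B) ∧ SupportedIn g (A ∪ B))
    (hinf : ∀ U : Set X, IsOpen U → U.Nonempty → U.Infinite)
    {M M₁ M₂ : Subgroup G} (hM : M.Normal) (h₁ : M₁ ≤ M)
    (hn : ∀ m ∈ M, ∀ a ∈ M₁, m * a * m⁻¹ ∈ M₁) (hc : ∀ a ∈ M₁, ∀ b ∈ M₂, Commute a b) :
    M₁ = ⊥ ∨ M₂ = ⊥ := by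
  by_contra! hne
  obtain ⟨f, hf, hf1⟩ := M₁.bot_or_exists_ne_one.resolve_left hne.1
  obtain ⟨f', hf', hf1'⟩ := M₂.bot_or_exists_ne_one.resolve_left hne.2
  obtain ⟨y, hy⟩ := exists_smul_ne (X := X) hf1'
  -- A whole open set is moved by `f`, and it is infinite, so the two forbidden points `y` and `f⁻¹
  -- • y` can be avoided.
  obtain ⟨x, hxf, hxy, hfxy⟩ : ∃ x : X, f • x ≠ x ∧ x ≠ y ∧ f • x ≠ y := by
    obtain ⟨x₀, hx₀⟩ := exists_smul_ne (X := X) hf1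
    obtain ⟨U, hU, hxU, -, hfU⟩ := exists_displaced hx₀ Filter.univ_mem
    obtain ⟨x, hx, hxn⟩ := (hinf U hU ⟨x₀, hxU⟩).exists_notMem_finite
      (Set.toFinite {y, f⁻¹ • y})
    simp only [Set.mem_insert_iff, Set.mem_singleton_iff, not_or] at hxn
    exact ⟨x, fun h => hfU x hx (h.symm ▸ hx), hxn.1, fun h => hxn.2 (eq_inv_smul_iff.2 h)⟩
  obtain ⟨B₀, hB₀, hyB₀, -, hfB₀⟩ := exists_displaced hy Filter.univ_mem
  obtain ⟨P, Q, hP, hQ, hxP, hyQ, hPQ⟩ := t2_separation hfxy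
  obtain ⟨A, hA, hxA, hAP, hfA⟩ := exists_displaced hxf
    ((hP.preimage (continuous_const_smul f)).mem_nhds hxP)
  obtain ⟨U, g, hU, hxU, hUA, hgU, hg⟩ := hX x y hxy A (hA.mem_nhds hxA) (B₀ ∩ Q)
    ((hB₀.inter hQ).mem_nhds ⟨hyB₀, hyQ⟩)
  have hfU : ∀ z ∈ U, f • z ∉ U := fun z hz h => hfA z (hUA hz) (hUA h)
  -- The double commutator trick: `a` and `b` are arbitrary, so normality only puts `⁅a, b⁆` in `M`;
  -- for `a`, `b` in `M` the same computation lands in `M₁`.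
  have key : ∀ a b : G, SupportedIn a U → SupportedIn b U → ⁅a, b⁆ ∈ M := fun a b ha hb => by
    rw [← commutator_commutator_of_displaced ha hb hfU]
    have h1 : ⁅a, f⁆ ∈ M := M.mul_mem (hM.conj_mem f (h₁ hf) a) (M.inv_mem (h₁ hf))
    rw [commutatorElement_def ⁅a, f⁆ b, mul_assoc, mul_assoc]
    exact M.mul_mem h1 (by simpa [mul_assoc] using hM.conj_mem _ (M.inv_mem h1) b)
  have key₁ : ∀ a ∈ M, ∀ b ∈ M, SupportedIn a U → SupportedIn b U → ⁅a, b⁆ ∈ M₁ :=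
    fun a haM b hbM ha hb => by
      rw [← commutator_commutator_of_displaced ha hb hfU]
      have h1 : ⁅a, f⁆ ∈ M₁ := M₁.mul_mem (hn a haM f hf) (M₁.inv_mem hf)
      rw [commutatorElement_def ⁅a, f⁆ b, mul_assoc, mul_assoc]
      exact M₁.mul_mem h1 (by simpa [mul_assoc] using hn b hbM _ (M₁.inv_mem h1))
  -- Commutators are taken twice: once to enter `M`, once more to enter `M₁`. The inner pair lives
  -- on a set displaced by the outer commutator, which keeps the result nontrivial.
  obtain ⟨h, hhM, hhU, hh1⟩ : ∃ h ∈ M₁, SupportedIn h U ∧ h ≠ 1 := by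
    obtain ⟨a, b, ha, hb, hab⟩ := hG.exists_commutator_ne_one hU ⟨x, hxU⟩
    obtain ⟨z, hz⟩ := exists_smul_ne (X := X) hab
    obtain ⟨W, hW, hzW, hWU, hcW⟩ := exists_displaced hz
      (hU.mem_nhds ((ha.commutator hb).mem_of_ne hz))
    obtain ⟨a', b', ha', hb', hab'⟩ := hG.exists_commutator_ne_one hW ⟨z, hzW⟩
    have hd := ha'.commutator hb'
    refine ⟨⁅⁅a, b⁆, ⁅a', b'⁆⁆, key₁ _ (key _ _ ha hb) _
      (key _ _ (ha'.mono hWU) (hb'.mono hWU)) (ha.commutator hb) (hd.mono hWU),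
      (ha.commutator hb).commutator (hd.mono hWU), fun h => hab' ?_⟩
    exact hd.eq_one_of_commute hcW (commutatorElement_eq_one_iff_commute.1 h).symm
  -- The element `g` need not lie in `M`, but `γ` does, and it agrees with `g` on `U` because `g`
  -- fixes `f • z` for z in `U`. So `γ` pushes `h` into `B₀`, which `f'` displaces.
  let γ := g * f⁻¹ * g⁻¹ * f
  have hγM : γ ∈ M := M.mul_mem (hM.conj_mem _ (M.inv_mem (h₁ hf)) g) (h₁ hf)
  have hγU : ∀ z ∈ U, γ • z ∈ B₀ := fun z hz => by
    have hfix : g⁻¹ • f • z = f • z := by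
      refine hg.inv _ ?_
      rintro (hA' | hB')
      · exact hfA z (hUA hz) hA'
      · exact Set.disjoint_left.1 hPQ (hAP (hUA hz)) hB'.2
    simp only [γ, mul_smul, hfix, inv_smul_smul]
    exact (hgU z hz).1
  have hconj : SupportedIn (γ * h * γ⁻¹) B₀ := hhU.conj γ hγU
  have := hconj.eq_one_of_commute hfB₀ (hc _ (hn γ hγM h hhM) f' hf')
  exact hh1 (by simpa using this)

end LocallyMoving

/-! ### Algebraic disjointness -/

/-- A group-theoretic substitute for having disjoint supports. -/
def AlgDisjoint {G : Type*} [Group G] (g f : G) : Prop :=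
  ∀ h, ¬ Commute f h → ∃ f₁ f₂, Commute f₁ g ∧ Commute f₂ g ∧
    Commute ⁅⁅f₁, h⁆, f₂⁆ g ∧ ⁅⁅f₁, h⁆, f₂⁆ ≠ 1

lemma AlgDisjoint.map {G H : Type*} [Group G] [Group H] (σ : G ≃* H) {g f : G}
    (h : AlgDisjoint g f) : AlgDisjoint (σ g) (σ f) := by
  intro k hk
  obtain ⟨f₁, f₂, h1, h2, h3, h4⟩ := h (σ.symm k) fun hc => hk (by simpa using hc.map σ)
  have e : ⁅⁅σ f₁, k⁆, σ f₂⁆ = σ ⁅⁅f₁, σ.symm k⁆, f₂⁆ := by simp [map_commutatorElement]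
  exact ⟨σ f₁, σ f₂, h1.map σ, h2.map σ, e ▸ h3.map σ, by
    rw [e]; exact fun h => h4 ((map_eq_one_iff σ σ.injective).1 h)⟩

/-- The closure of the set of points moved by `g`. -/
def closedSupport {G : Type*} (X : Type*) [Group G] [TopologicalSpace X] [MulAction G X]
    (g : G) : Set X := closure {x | g • x ≠ x}

lemma closedSupport_subset_iff {G X : Type*} [Group G] [TopologicalSpace X] [MulAction G X]
    {g f : G} :
    closedSupport X g ⊆ closedSupport X f ↔ SupportedIn g (closedSupport X f) := by
  constructor
  · intro h x hx
    by_contra hgx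
    exact hx (h (subset_closure hgx))
  · intro h
    exact closure_minimal (fun x hx => h.mem_of_ne hx) isClosed_closure

lemma exists_smul_ne_of_not_commute {G X : Type*} [Group G] [MulAction G X] [FaithfulSMul G X]
    {f h : G} (hfh : ¬ Commute f h) :
    ∃ x : X, f • x ≠ x ∧ h • x ≠ x := by
  by_contra! H
  refine hfh (SupportedIn.commute (U := {x : X | f • x ≠ x}) (fun x hx => ?_) fun x hx => ?_)
  · simpa using hx
  · exact H x (by simpa using hx)

section Rubin

variable {G X : Type*} [Group G] [TopologicalSpace X] [T2Space X] [MulAction G X]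
  [ContinuousConstSMul G X]

lemma smul_eq_of_mem_closedSupport {g f : G} (h : ∀ x : X, f • x ≠ x → g • x = x) {x : X}
    (hx : x ∈ closedSupport X f) : g • x = x :=
  closure_minimal (t := {x : X | g • x = x}) h
    (isClosed_eq (continuous_const_smul g) continuous_id) hx

/-- Serves a pigeonhole among five iterates of `g`, whose indices differ by 1 to 4; 12 is the least
common multiple of 1, 2, 3, 4. -/
lemma exists_displaced_powers {g : G} {x : X} (hx : g ^ 12 • x ≠ x) {W : Set X}
    (hW : W ∈ 𝓝 x) : ∃ U : Set X, IsOpen U ∧ x ∈ U ∧ U ⊆ W ∧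
      ∀ k, 1 ≤ k → k ≤ 4 → ∀ y ∈ U, g ^ k • y ∉ U := by
  have hne : ∀ k, 1 ≤ k → k ≤ 4 → g ^ k • x ≠ x := by
    intro k h1 h4 hk
    have hd : k ∣ 12 := by interval_cases k <;> decide
    obtain ⟨l, hl⟩ := hd
    apply hx
    rw [hl, pow_mul]
    generalize g ^ k = q at hk
    clear hl
    induction l with
    | zero => simp
    | succ l ih => rw [pow_succ, mul_smul, hk, ih]
  have hd := fun k h1 h4 => exists_displaced (hne k h1 h4) hW
  obtain ⟨U1, o1, x1, s1, d1⟩ := hd 1 (by norm_num) (by norm_num)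
  obtain ⟨U2, o2, x2, s2, d2⟩ := hd 2 (by norm_num) (by norm_num)
  obtain ⟨U3, o3, x3, s3, d3⟩ := hd 3 (by norm_num) (by norm_num)
  obtain ⟨U4, o4, x4, s4, d4⟩ := hd 4 (by norm_num) (by norm_num)
  refine ⟨U1 ∩ U2 ∩ U3 ∩ U4, ((o1.inter o2).inter o3).inter o4, ⟨⟨⟨x1, x2⟩, x3⟩, x4⟩,
    fun y hy => s4 hy.2, fun k h1 h4 y hy hgy => ?_⟩
  interval_cases k
  · exact d1 y hy.1.1.1 hgy.1.1.1
  · exact d2 y hy.1.1.2 hgy.1.1.2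
  · exact d3 y hy.1.2 hgy.1.2
  · exact d4 y hy.2 hgy.2

variable [FaithfulSMul G X]

/-- Inside the set moved by `f`, take an open set displaced by `k`. Elements supported there commute
with `g`, and the double commutator collapses to their commutator. -/
lemma LocallyMoving.algDisjoint (hG : LocallyMoving G X) {g f : G}
    (h : ∀ x : X, f • x ≠ x → g • x = x) : AlgDisjoint g f := by
  intro k hk
  obtain ⟨x, hfx, hkx⟩ := exists_smul_ne_of_not_commute (X := X) hk
  have hopen : IsOpen {x : X | f • x ≠ x} :=
    isOpen_ne_fun (continuous_const_smul f) continuous_id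
  obtain ⟨U, hU, hxU, hUf, hkU⟩ := exists_displaced hkx (hopen.mem_nhds hfx)
  obtain ⟨a, b, ha, hb, hab⟩ := hG.exists_commutator_ne_one hU ⟨x, hxU⟩
  have hg : SupportedIn g Uᶜ := fun y hy => h y (hUf (by simpa using hy))
  refine ⟨a, b, ha.commute hg, hb.commute hg, ?_, ?_⟩ <;>
    rw [commutator_commutator_of_displaced ha hb hkU]
  exacts [(ha.commutator hb).commute hg, hab]

/-- Otherwise some neighbourhood `U` is displaced by `g`, ..., `g ^ 4`. The double commutator is
supported in four translates of `U` by elements commuting with `g`, yet moves five points of one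
`g`-orbit; two of them share a translate. -/
lemma LocallyMoving.pow_smul_eq (hG : LocallyMoving G X) {g f : G} (h : AlgDisjoint g f)
    {x : X} (hx : f • x ≠ x) : g ^ 12 • x = x := by
  by_contra hgx
  obtain ⟨W, hW, hxW, -, hfW⟩ := exists_displaced hx Filter.univ_mem
  obtain ⟨U, hU, hxU, hUW, hgU⟩ := exists_displaced_powers hgx (hW.mem_nhds hxW)
  obtain ⟨k, hk, hk1⟩ := hG.exists_ne_one hU ⟨x, hxU⟩
  obtain ⟨f₁, f₂, h1, h2, h3, h4⟩ := h k fun hc =>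
    hk1 ((hk.mono hUW).eq_one_of_commute hfW hc.symm)
  obtain ⟨s, hs⟩ := exists_smul_ne (X := X) h4
  -- Expanding `⁅⁅f₁, k⁆, f₂⁆` gives conjugates of `k` and `k⁻¹` by exactly these four elements.
  let e : Fin 4 → G := ![1, f₁, f₂, f₂ * f₁]
  have he : ∀ i, Commute (e i) g := by
    intro i
    fin_cases i
    · exact Commute.one_left g
    · exact h1
    · exact h2
    · exact h2.mul_left h1
  have hsupp : SupportedIn ⁅⁅f₁, k⁆, f₂⁆ {y : X | ∃ i, (e i)⁻¹ • y ∈ U} := by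
    have hA : SupportedIn ⁅f₁, k⁆ {y : X | y ∈ U ∨ f₁⁻¹ • y ∈ U} := by
      rw [commutatorElement_def]
      exact (hk.conj f₁ fun y hy => Or.inr (by simpa using hy)).mul
        (hk.inv.mono fun y hy => Or.inl hy)
    rw [commutatorElement_def, mul_assoc, mul_assoc, ← mul_assoc f₂]
    refine (hA.mono ?_).mul (hA.inv.conj f₂ ?_)
    · rintro y (hy | hy)
      · exact ⟨0, by simpa [e] using hy⟩
      · exact ⟨1, hy⟩
    · rintro y (hy | hy)
      · exact ⟨2, by simpa [e] using hy⟩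
      · exact ⟨3, by simpa [e, mul_smul] using hy⟩
  have hmem : ∀ n : Fin 5, ∃ i, (e i)⁻¹ • g ^ (n : ℕ) • s ∈ U := fun n => by
    refine hsupp.mem_of_ne (x := g ^ (n : ℕ) • s) fun hn => hs ?_
    rw [← mul_smul, (h3.pow_right (n : ℕ)).eq, mul_smul] at hn
    exact smul_left_cancel _ hn
  choose j hj using hmem
  obtain ⟨a, b, hab, hjab⟩ := Fintype.exists_ne_map_eq_of_card_lt j (by simp)
  have main : ∀ a b : Fin 5, a < b → j a = j b → False := by
    intro a b hab hjab
    have hb := hj b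
    have hpow : g ^ (b : ℕ) = g ^ ((b : ℕ) - a) * g ^ (a : ℕ) := by
      rw [← pow_add, Nat.sub_add_cancel (le_of_lt hab)]
    rw [hpow, ← hjab, ← mul_smul, ← mul_assoc, ((he (j a)).inv_left.pow_right _).eq, mul_assoc,
      mul_smul, mul_smul] at hb
    exact hgU _ (by have : (a : ℕ) < b := hab; omega) (by omega) _ (hj a) hb
  rcases lt_or_gt_of_ne hab with hlt | hlt
  · exact main a b hlt hjab
  · exact main b a hlt hjab.symm

/-- Being supported in the closed support of `f` is a group-theoretic property. -/
lemma LocallyMoving.supportedIn_iff (hG : LocallyMoving G X) {h f : G} :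
    SupportedIn h (closedSupport X f) ↔ ∀ g, AlgDisjoint g f → Commute h (g ^ 12) := by
  constructor
  · intro hh g hg
    refine hh.commute fun x hx => ?_
    exact smul_eq_of_mem_closedSupport (fun y hy => hG.pow_smul_eq hg hy) (by simpa using hx)
  · intro H x hx
    by_contra hhx
    obtain ⟨U, hU, hxU, hUf, hhU⟩ := exists_displaced hhx
      (isClosed_closure.isOpen_compl.mem_nhds hx)
    -- The twelfth power must survive here, since only `g ^ 12` is known to commute with `h`.
    obtain ⟨g, hg, hg1⟩ := hG U hU ⟨x, hxU⟩
    refine hg1 ((hg.pow 12).eq_one_of_commute hhU (H g (hG.algDisjoint fun y hy => ?_)).symm)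
    exact hg y fun hyU => hUf hyU (subset_closure hy)

/-- The criterion of `supportedIn_iff` involves only the group structure, so `σ` transports it. -/
theorem LocallyMoving.closedSupport_subset_map (hG : LocallyMoving G X) (σ : G ≃* G) {h f : G}
    (H : closedSupport X h ⊆ closedSupport X f) :
    closedSupport X (σ h) ⊆ closedSupport X (σ f) := by
  rw [closedSupport_subset_iff, hG.supportedIn_iff] at H ⊢
  intro g hg
  have h1 := (H (σ.symm g) (by simpa using hg.map σ.symm)).map σ
  simpa using h1

end Rubin

/-! ### The action of Thompson's group on the Cantor space -/

instance : MulAction thompsonV Cantor where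
  smul v x := v.1 x
  one_smul _ := rfl
  mul_smul _ _ _ := rfl

instance : ContinuousConstSMul thompsonV Cantor := ⟨fun v => v.1.continuous⟩

instance : FaithfulSMul thompsonV Cantor :=
  ⟨fun h => Subtype.ext (Homeomorph.ext h)⟩

/-- The sequence obtained from `x` by deleting the first `n` letters. -/
def drop (n : ℕ) (x : Cantor) : Cantor := fun k => x (n + k)

lemma drop_app (m : List Bool) (z : Cantor) : drop m.length (app m z) = z := by
  induction m with
  | nil => funext k; simp [drop, app]
  | cons b m ih =>
    funext k
    have := congrFun ih k
    simp only [drop, List.length_cons] at this ⊢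
    rw [add_right_comm]
    exact this

lemma continuous_drop (n : ℕ) : Continuous (drop n) :=
  continuous_pi fun k => continuous_apply (n + k)

lemma continuous_app (m : List Bool) : Continuous (app m) := by
  induction m with
  | nil => exact continuous_id
  | cons b m ih =>
    refine continuous_pi fun n => ?_
    cases n with
    | zero => exact continuous_const
    | succ n => exact (continuous_apply n).comp ih

lemma isClopen_sdi (m : List Bool) : IsClopen (sdi m) :=
  ⟨(isCompact_range (continuous_app m)).isClosed, isOpen_sdi m⟩

lemma app_mem_sdi (m : List Bool) (z : Cantor) : app m z ∈ sdi m := ⟨z, rfl⟩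

lemma sdi_append_subset (m w : List Bool) : sdi (m ++ w) ⊆ sdi m := by
  rintro _ ⟨z, rfl⟩
  exact ⟨app w z, (app_append m w z).symm⟩

lemma sdi_disjoint_of_head_ne {b c : Bool} (h : b ≠ c) (m w : List Bool) :
    Disjoint (sdi (b :: m)) (sdi (c :: w)) := by
  rw [Set.disjoint_left]
  rintro _ ⟨z, rfl⟩ ⟨y, hy⟩
  exact h (app_cons_inj hy).1.symm

lemma sdi_append_disjoint (u : List Bool) {m w : List Bool} (h : Disjoint (sdi m) (sdi w)) :
    Disjoint (sdi (u ++ m)) (sdi (u ++ w)) := by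
  rw [Set.disjoint_left] at h ⊢
  rintro _ ⟨z, rfl⟩ ⟨y, hy⟩
  rw [app_append, app_append] at hy
  exact h (app_mem_sdi m z) (app_injective u hy ▸ app_mem_sdi w y)

lemma app_apply_of_lt (m : List Bool) (y z : Cantor) {i : ℕ} (hi : i < m.length) :
    app m y i = app m z i := by
  induction m generalizing i with
  | nil => simp at hi
  | cons b m ih =>
    cases i with
    | zero => rfl
    | succ i => exact ih (by simpa using hi)

lemma exists_sdi_subset {U : Set Cantor} (hU : IsOpen U) {x : Cantor} (hx : x ∈ U) :
    ∃ N, ∀ m : List Bool, N ≤ m.length → x ∈ sdi m → sdi m ⊆ U := by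
  obtain ⟨_, ⟨y, n, rfl⟩, hxy, hs⟩ :=
    (PiNat.isTopologicalBasis_cylinders fun _ : ℕ => Bool).exists_subset_of_mem_open hx hU
  refine ⟨n, fun m hm hxm y' hy' => hs ?_⟩
  obtain ⟨z, rfl⟩ := hxm
  obtain ⟨z', rfl⟩ := hy'
  intro i hi
  rw [app_apply_of_lt m z' z (hi.trans_le hm)]
  exact hxy i hi

lemma exists_mem_sdi_subset {U : Set Cantor} (hU : IsOpen U) {x : Cantor} (hx : x ∈ U) :
    ∃ m : List Bool, m ≠ [] ∧ x ∈ sdi m ∧ sdi m ⊆ U := by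
  obtain ⟨N, hN⟩ := exists_sdi_subset hU hx
  obtain ⟨m, hm, z, rfl⟩ := exists_word (N + 1) x
  exact ⟨m, by rintro rfl; simp at hm, app_mem_sdi m z, hN m (by omega) (app_mem_sdi m z)⟩

lemma infinite_of_isOpen {U : Set Cantor} (hU : IsOpen U) (hne : U.Nonempty) : U.Infinite := by
  obtain ⟨x, hx⟩ := hne
  obtain ⟨m, -, -, hm⟩ := exists_mem_sdi_subset hU hx
  exact (Set.infinite_range_of_injective (app_injective m)).mono hm

/-! ### Exchanging two dyadic intervals -/

lemma continuous_of_level {f : Cantor → Cantor} (N : ℕ)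
    (h : ∀ m : List Bool, m.length = N → ∃ w, ∀ z, f (app m z) = app w z) : Continuous f := by
  rw [continuous_iff_continuousAt]
  intro x
  obtain ⟨m, hm, z, rfl⟩ := exists_word N x
  obtain ⟨w, hw⟩ := h m hm
  have : f =ᶠ[𝓝 (app m z)] fun y => app w (drop m.length y) := by
    filter_upwards [(isOpen_sdi m).mem_nhds (app_mem_sdi m z)] with y hy
    obtain ⟨z', rfl⟩ := hy
    rw [hw, drop_app]
  exact (((continuous_app w).comp (continuous_drop _)).continuousAt).congr this.symm

open Classical in
/-- Exchange the prefixes `m` and `w`, and fix the points having neither as a prefix. -/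
noncomputable def swapFun (m w : List Bool) (x : Cantor) : Cantor :=
  if x ∈ sdi m then app w (drop m.length x)
  else if x ∈ sdi w then app m (drop w.length x) else x

section Swap

variable {m w : List Bool}

lemma swapFun_left (z : Cantor) : swapFun m w (app m z) = app w z := by
  rw [swapFun, if_pos (app_mem_sdi m z), drop_app]

lemma swapFun_right (h : Disjoint (sdi m) (sdi w)) (z : Cantor) :
    swapFun m w (app w z) = app m z := by
  rw [swapFun, if_neg (Set.disjoint_right.1 h (app_mem_sdi w z)), if_pos (app_mem_sdi w z),
    drop_app]

lemma swapFun_of_notMem {x : Cantor} (hm : x ∉ sdi m) (hw : x ∉ sdi w) :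
    swapFun m w x = x := by
  rw [swapFun, if_neg hm, if_neg hw]

lemma swapFun_involutive (h : Disjoint (sdi m) (sdi w)) :
    Function.Involutive (swapFun m w) := by
  intro x
  by_cases hm : x ∈ sdi m
  · obtain ⟨z, rfl⟩ := hm
    rw [swapFun_left, swapFun_right h]
  by_cases hw : x ∈ sdi w
  · obtain ⟨z, rfl⟩ := hw
    rw [swapFun_right h, swapFun_left]
  rw [swapFun_of_notMem hm hw, swapFun_of_notMem hm hw]

lemma swapFun_level (h : Disjoint (sdi m) (sdi w)) (u : List Bool)
    (hu : u.length = m.length + w.length) : ∃ t, ∀ z, swapFun m w (app u z) = app t z := by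
  by_cases hm : ∃ z, app u z ∈ sdi m
  · obtain ⟨z, y, hy⟩ := hm
    obtain ⟨r, rfl, -⟩ := prefix_of_app_eq hy (by omega)
    exact ⟨w ++ r, fun z => by rw [app_append, app_append, swapFun_left]⟩
  by_cases hw : ∃ z, app u z ∈ sdi w
  · obtain ⟨z, y, hy⟩ := hw
    obtain ⟨r, rfl, -⟩ := prefix_of_app_eq hy (by omega)
    exact ⟨m ++ r, fun z => by rw [app_append, app_append, swapFun_right h]⟩
  push Not at hm hw
  exact ⟨u, fun z => swapFun_of_notMem (hm z) (hw z)⟩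

/-- The element of Thompson's group exchanging two disjoint dyadic intervals. -/
noncomputable def swap (h : Disjoint (sdi m) (sdi w)) : thompsonV :=
  ⟨{ toEquiv := (swapFun_involutive h).toPerm
     continuous_toFun := continuous_of_level _ (swapFun_level h)
     continuous_invFun := continuous_of_level _ (swapFun_level h) },
    isThompson_of_level _ (swapFun_level h)⟩

lemma swap_smul_left (h : Disjoint (sdi m) (sdi w)) (z : Cantor) :
    swap h • app m z = app w z := swapFun_left z

lemma swap_smul_right (h : Disjoint (sdi m) (sdi w)) (z : Cantor) :
    swap h • app w z = app m z := swapFun_right h z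

lemma swap_supportedIn (h : Disjoint (sdi m) (sdi w)) :
    SupportedIn (swap h) (sdi m ∪ sdi w) := fun _ hx =>
  swapFun_of_notMem (fun h => hx (Or.inl h)) fun h => hx (Or.inr h)

end Swap

/-- A product of two exchanges through the sibling interval. It has infinite order, and for `m = []`
it fixes the constant sequence b with τ = α_b⁻¹ there. -/
lemma exists_dilation (m : List Bool) (b : Bool) : ∃ v : thompsonV,
    (∀ z, v • app (m ++ [b]) z = app (m ++ [b, b]) z) ∧ SupportedIn v (sdi m) := by
  have hb : b ≠ !b := by cases b <;> decide
  have h₁ : Disjoint (sdi (m ++ [b])) (sdi (m ++ [!b])) :=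
    sdi_append_disjoint m (sdi_disjoint_of_head_ne hb [] [])
  have h₂ : Disjoint (sdi (m ++ [!b])) (sdi (m ++ [b, b])) :=
    sdi_append_disjoint m (sdi_disjoint_of_head_ne hb.symm [] [b])
  refine ⟨swap h₂ * swap h₁, fun z => ?_, ?_⟩
  · rw [mul_smul, swap_smul_left, swap_smul_left]
  · exact ((swap_supportedIn h₂).mono (Set.union_subset (sdi_append_subset _ _)
      (sdi_append_subset _ _))).mul ((swap_supportedIn h₁).mono
        (Set.union_subset (sdi_append_subset _ _) (sdi_append_subset _ _)))

theorem locallyMoving_thompsonV : LocallyMoving thompsonV Cantor := by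
  rintro U hU ⟨x, hx⟩
  obtain ⟨m, -, -, hm⟩ := exists_mem_sdi_subset hU hx
  obtain ⟨v, hv, hs⟩ := exists_dilation m false
  refine ⟨v, hs.mono hm, fun h => ?_⟩
  have hpow : ∀ (k : ℕ) (z : Cantor),
      v ^ k • app (m ++ [false]) z = app (m ++ [false]) (app (List.replicate k false) z) := by
    intro k
    induction k with
    | zero => intro z; simp [app]
    | succ k ih =>
      intro z
      have : app (m ++ [false, false]) z = app (m ++ [false]) (app [false] z) := by
        rw [← app_append]; simp
      rw [pow_succ, mul_smul, hv, this, ih, List.replicate_succ', app_append (List.replicate k false)]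
  have h12 := hpow 12 fun _ => true
  rw [h, one_smul] at h12
  simpa [app, List.replicate] using congrFun (app_injective _ h12) 0

lemma exists_smul_mem_supportedIn {x y : Cantor} (hxy : x ≠ y) {A B : Set Cantor}
    (hA : A ∈ 𝓝 x) (hB : B ∈ 𝓝 y) : ∃ (U : Set Cantor) (g : thompsonV), IsOpen U ∧ x ∈ U ∧
      U ⊆ A ∧ (∀ z ∈ U, g • z ∈ B) ∧ SupportedIn g (A ∪ B) := by
  obtain ⟨P, Q, hP, hQ, hxP, hyQ, hPQ⟩ := t2_separation hxy
  obtain ⟨m, -, hxm, hm⟩ := exists_mem_sdi_subset (isOpen_interior.inter hP)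
    ⟨mem_interior_iff_mem_nhds.2 hA, hxP⟩
  obtain ⟨w, -, hyw, hw⟩ := exists_mem_sdi_subset (isOpen_interior.inter hQ)
    ⟨mem_interior_iff_mem_nhds.2 hB, hyQ⟩
  have h : Disjoint (sdi m) (sdi w) :=
    hPQ.mono (hm.trans Set.inter_subset_right) (hw.trans Set.inter_subset_right)
  have hmA : sdi m ⊆ A := fun z hz => interior_subset (hm hz).1
  have hwB : sdi w ⊆ B := fun z hz => interior_subset (hw hz).1
  refine ⟨sdi m, swap h, isOpen_sdi m, hxm, hmA, ?_,
    (swap_supportedIn h).mono (Set.union_subset_union hmA hwB)⟩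
  rintro _ ⟨z, rfl⟩
  rw [swap_smul_left]
  exact hwB (app_mem_sdi w z)

theorem thompsonV_eq_bot_or_eq_bot {M M₁ M₂ : Subgroup thompsonV} (hM : M.Normal)
    (h₁ : M₁ ≤ M) (hn : ∀ m ∈ M, ∀ a ∈ M₁, m * a * m⁻¹ ∈ M₁)
    (hc : ∀ a ∈ M₁, ∀ b ∈ M₂, Commute a b) : M₁ = ⊥ ∨ M₂ = ⊥ :=
  locallyMoving_thompsonV.eq_bot_or_eq_bot
    (fun _ _ hxy _ hA _ hB => exists_smul_mem_supportedIn hxy hA hB)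
    (fun _ hU hne => infinite_of_isOpen hU hne) hM h₁ hn hc

/-- Thompson's group is transitive on proper dyadic intervals, even by elements that are
trivial near a point outside of both. -/
lemma exists_adapted_of_ne_nil {m w : List Bool} (hm : m ≠ []) (hw : w ≠ []) (x : Cantor) :
    ∃ v : thompsonV, Adapted v.1 m w ∧
      (x ∉ sdi m → x ∉ sdi w → x ∉ closedSupport Cantor v) := by
  have key : ∀ (v : thompsonV) (U : Set Cantor), IsClosed U → SupportedIn v U → x ∉ U →
      x ∉ closedSupport Cantor v := fun v U hU hv hx hxv =>
    hx (closure_minimal (fun y hy => hv.mem_of_ne hy) hU hxv)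
  obtain ⟨b, m, rfl⟩ := List.exists_cons_of_ne_nil hm
  obtain ⟨c, w, rfl⟩ := List.exists_cons_of_ne_nil hw
  by_cases hbc : b = c
  · subst hbc
    have hb : b ≠ !b := by cases b <;> decide
    -- When both words start with `b`, the exchange passes through an interval in the other half;
    -- its second letter is chosen to avoid `x`.
    have h₁ := sdi_disjoint_of_head_ne hb m [!x 1]
    have h₂ := sdi_disjoint_of_head_ne hb.symm [!x 1] w
    have hx : x ∉ sdi [!b, !x 1] := by
      rintro ⟨z, hz⟩
      have : (!x 1) = x 1 := congrFun hz 1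
      simp at this
    refine ⟨swap h₂ * swap h₁, fun z => ?_, fun hxm hxw => ?_⟩
    · change (swap h₂ * swap h₁) • app (b :: m) z = _
      rw [mul_smul, swap_smul_left, swap_smul_left]
    · refine key _ (sdi (b :: m) ∪ sdi [!b, !x 1] ∪ sdi (b :: w)) ?_ (.mul ?_ ?_) ?_
      · exact ((isClopen_sdi _).1.union (isClopen_sdi _).1).union (isClopen_sdi _).1
      · exact (swap_supportedIn h₂).mono fun y hy => hy.elim (fun h => Or.inl (Or.inr h)) Or.inr
      · exact (swap_supportedIn h₁).mono fun y hy => Or.inl hy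
      · rintro ((h | h) | h)
        exacts [hxm h, hx h, hxw h]
  · have h := sdi_disjoint_of_head_ne hbc m w
    refine ⟨swap h, fun z => swap_smul_left h z, fun hxm hxw => ?_⟩
    exact key _ _ ((isClopen_sdi _).1.union (isClopen_sdi _).1) (swap_supportedIn h)
      fun hx => hx.elim hxm hxw

/-! ### Automorphisms of Thompson's group are spatial -/

lemma notMem_closedSupport_iff {v : thompsonV} {x : Cantor} :
    x ∉ closedSupport Cantor v ↔ ∀ᶠ y in 𝓝 x, v • y = y := by
  rw [closedSupport, mem_closure_iff_frequently, Filter.not_frequently]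
  simp

/-- A prefix exchange that is the identity on some nonempty open subset of its interval has equal
words, hence is the identity on the whole interval. -/
lemma isOpen_closedSupport (v : thompsonV) : IsOpen (closedSupport Cantor v) := by
  rw [isOpen_iff_mem_nhds]
  intro x hx
  obtain ⟨⟨m, w⟩, hxm, hv⟩ := exists_adapted v x
  filter_upwards [(isOpen_sdi m).mem_nhds hxm] with y hy
  by_contra hyv
  rw [notMem_closedSupport_iff] at hyv
  refine notMem_closedSupport_iff.2 ?_ hx
  obtain ⟨z, rfl⟩ := hy
  obtain ⟨U, hU, hUo, hyU⟩ := eventually_nhds_iff.1 hyv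
  obtain ⟨N, hN⟩ := exists_sdi_subset hUo hyU
  obtain ⟨r, hr, z', rfl⟩ := exists_word N z
  have hs : sdi (m ++ r) ⊆ U := hN _ (by simp [hr]) ⟨z', app_append _ _ _⟩
  have hmw : m ++ r = w ++ r := eq_of_app_eq fun y => by
    rw [← hU _ (hs (app_mem_sdi _ y)), app_append, app_append]
    exact hv _
  have hmw' : m = w := List.append_cancel_right hmw
  filter_upwards [(isOpen_sdi m).mem_nhds hxm] with y hy
  obtain ⟨z, rfl⟩ := hy
  exact (hv z).trans (by rw [hmw'])

lemma closedSupport_subset_of_supportedIn {v : thompsonV} {U : Set Cantor} (hU : IsClosed U)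
    (h : SupportedIn v U) : closedSupport Cantor v ⊆ U :=
  closure_minimal (fun _ hy => h.mem_of_ne hy) hU

lemma exists_closedSupport_eq_sdi (m : List Bool) :
    ∃ v : thompsonV, closedSupport Cantor v = sdi m := by
  have h : Disjoint (sdi (m ++ [false])) (sdi (m ++ [true])) :=
    sdi_append_disjoint m (sdi_disjoint_of_head_ne (by decide) [] [])
  refine ⟨swap h, Set.Subset.antisymm (closedSupport_subset_of_supportedIn (isClopen_sdi m).1
    ((swap_supportedIn h).mono (Set.union_subset (sdi_append_subset _ _)
      (sdi_append_subset _ _)))) fun x hx => subset_closure ?_⟩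
  obtain ⟨z, rfl⟩ := hx
  intro hfix
  obtain ⟨r, hr, z', rfl⟩ := exists_word 1 z
  obtain ⟨b, rfl⟩ := List.length_eq_one_iff.1 hr
  rw [← app_append] at hfix
  cases b
  · rw [swap_smul_left] at hfix
    exact Set.disjoint_left.1 h (app_mem_sdi _ z') (hfix ▸ app_mem_sdi _ z')
  · rw [swap_smul_right] at hfix
    exact Set.disjoint_left.1 h (app_mem_sdi _ z') (hfix ▸ app_mem_sdi _ z')

lemma mem_closedSupport_conj {v f : thompsonV} {x : Cantor} :
    v • x ∈ closedSupport Cantor f ↔ x ∈ closedSupport Cantor (v⁻¹ * f * v) := by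
  rw [← not_iff_not, notMem_closedSupport_iff, notMem_closedSupport_iff]
  have : 𝓝 (v • x) = (𝓝 x).map (v.1 ·) := (v.1.map_nhds_eq x).symm
  rw [this, Filter.eventually_map]
  refine Filter.eventually_congr (Filter.Eventually.of_forall fun y => ?_)
  rw [mul_smul, mul_smul, inv_smul_eq_iff]
  rfl

section Spatial

variable (σ : thompsonV ≃* thompsonV)

lemma closedSupport_map_subset_iff {h f : thompsonV} :
    closedSupport Cantor (σ h) ⊆ closedSupport Cantor (σ f) ↔
      closedSupport Cantor h ⊆ closedSupport Cantor f :=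
  ⟨fun H => by
    simpa using locallyMoving_thompsonV.closedSupport_subset_map σ.symm H,
    locallyMoving_thompsonV.closedSupport_subset_map σ⟩

lemma closedSupport_nonempty_iff {v : thompsonV} :
    (closedSupport Cantor v).Nonempty ↔ v ≠ 1 := by
  rw [closedSupport, closure_nonempty_iff]
  constructor
  · rintro ⟨x, hx⟩ rfl
    exact hx (one_smul _ x)
  · exact fun h => exists_smul_ne h

/-- Supports are open and every dyadic interval is a support, so overlapping supports contain a
common nontrivial one. Disjointness is thereby expressed through inclusion, which `σ` preserves. -/
lemma closedSupport_disjoint_iff {h f : thompsonV} :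
    Disjoint (closedSupport Cantor h) (closedSupport Cantor f) ↔
      ∀ t : thompsonV, closedSupport Cantor t ⊆ closedSupport Cantor h →
        closedSupport Cantor t ⊆ closedSupport Cantor f → t = 1 := by
  constructor
  · intro hd t h1 h2
    by_contra ht
    obtain ⟨x, hx⟩ := closedSupport_nonempty_iff.2 ht
    exact Set.disjoint_left.1 hd (h1 hx) (h2 hx)
  · intro H
    rw [Set.disjoint_left]
    intro x hxh hxf
    obtain ⟨m, -, -, hm⟩ := exists_mem_sdi_subset
      ((isOpen_closedSupport h).inter (isOpen_closedSupport f)) ⟨hxh, hxf⟩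
    obtain ⟨t, ht⟩ := exists_closedSupport_eq_sdi m
    refine closedSupport_nonempty_iff.1 (ht ▸ ⟨_, app_mem_sdi m x⟩) (H t ?_ ?_)
    · exact ht ▸ hm.trans Set.inter_subset_left
    · exact ht ▸ hm.trans Set.inter_subset_right

lemma closedSupport_disjoint_map {h f : thompsonV}
    (H : Disjoint (closedSupport Cantor h) (closedSupport Cantor f)) :
    Disjoint (closedSupport Cantor (σ h)) (closedSupport Cantor (σ f)) := by
  rw [closedSupport_disjoint_iff] at H ⊢
  intro t h1 h2
  have ht : t = σ (σ.symm t) := by simp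
  rw [ht, closedSupport_map_subset_iff] at h1 h2
  rw [ht, H _ h1 h2, map_one]

/-- The points `x` and `y` correspond under `σ`. -/
def Corresponds (x y : Cantor) : Prop :=
  ∀ f, x ∈ closedSupport Cantor f → y ∈ closedSupport Cantor (σ f)

variable {σ} in
lemma Corresponds.mem_iff {x y : Cantor} (h : Corresponds σ x y) (f : thompsonV) :
    y ∈ closedSupport Cantor (σ f) ↔ x ∈ closedSupport Cantor f := by
  refine ⟨fun hy => ?_, h f⟩
  by_contra hx
  obtain ⟨m, -, hxm, hm⟩ := exists_mem_sdi_subset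
    (isClosed_closure (s := {x : Cantor | f • x ≠ x})).isOpen_compl hx
  obtain ⟨t, ht⟩ := exists_closedSupport_eq_sdi m
  have hd : Disjoint (closedSupport Cantor t) (closedSupport Cantor f) := by
    rw [ht]; exact Set.disjoint_left.2 hm
  exact Set.disjoint_left.1 (closedSupport_disjoint_map σ hd) (h t (ht ▸ hxm)) hy

variable {σ} in
lemma Corresponds.symm {x y : Cantor} (h : Corresponds σ x y) : Corresponds σ.symm y x := by
  intro f hf
  rw [← h.mem_iff]
  simpa using hf

/-- Compactness: the images of the supports around `x` are nonempty and closed. They are directed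
because two supports containing `x` both contain the support of a smaller interval around `x`. -/
lemma exists_corresponds (x : Cantor) : ∃ y, Corresponds σ x y := by
  let ι := {f : thompsonV // x ∈ closedSupport Cantor f}
  have : Nonempty ι := by
    obtain ⟨t, ht⟩ := exists_closedSupport_eq_sdi []
    exact ⟨t, ht ▸ app_mem_sdi [] x⟩
  have hdir : Directed (· ⊇ ·) fun f : ι => closedSupport Cantor (σ f.1) := by
    rintro ⟨f, hf⟩ ⟨g, hg⟩
    obtain ⟨m, -, hxm, hm⟩ := exists_mem_sdi_subset
      ((isOpen_closedSupport f).inter (isOpen_closedSupport g)) ⟨hf, hg⟩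
    obtain ⟨t, ht⟩ := exists_closedSupport_eq_sdi m
    refine ⟨⟨t, ht ▸ hxm⟩, (closedSupport_map_subset_iff σ).2 ?_,
      (closedSupport_map_subset_iff σ).2 ?_⟩
    · rw [ht]; exact hm.trans Set.inter_subset_left
    · rw [ht]; exact hm.trans Set.inter_subset_right
  have hne : ∀ f : ι, (closedSupport Cantor (σ f.1)).Nonempty := by
    rintro ⟨f, hf⟩
    rw [closedSupport_nonempty_iff]
    intro h
    exact closedSupport_nonempty_iff.1 ⟨x, hf⟩ ((map_eq_one_iff σ σ.injective).1 h)
  obtain ⟨y, hy⟩ := IsCompact.nonempty_iInter_of_directed_nonempty_isCompact_isClosed _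
    hdir hne (fun _ => isClosed_closure.isCompact) (fun _ => isClosed_closure)
  exact ⟨y, fun f hf => Set.mem_iInter.1 hy ⟨f, hf⟩⟩

variable {σ} in
lemma Corresponds.eq {x y y' : Cantor} (h : Corresponds σ x y) (h' : Corresponds σ x y') :
    y = y' := by
  by_contra hne
  obtain ⟨m, -, hym, hm⟩ := exists_mem_sdi_subset (isOpen_ne (x := y')) hne
  obtain ⟨t, ht⟩ := exists_closedSupport_eq_sdi m
  have e : σ (σ.symm t) = t := σ.apply_symm_apply t
  have h1 : x ∈ closedSupport Cantor (σ.symm t) := by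
    rw [← h.mem_iff, e, ht]; exact hym
  rw [← h'.mem_iff, e, ht] at h1
  exact hm h1 rfl

/-- Every automorphism `σ` of Thompson's group is the conjugation by a homeomorphism of the
Cantor space. -/
theorem exists_homeomorph_of_mulEquiv : ∃ φ : Cantor ≃ₜ Cantor,
    (∀ (v : thompsonV) x, φ (v • x) = σ v • φ x) ∧
    ∀ (v : thompsonV) x, φ x ∈ closedSupport Cantor (σ v) ↔ x ∈ closedSupport Cantor v := by
  choose f hf using exists_corresponds σ
  choose g hg using exists_corresponds σ.symm
  let e : Cantor ≃ Cantor :=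
    { toFun := f
      invFun := g
      left_inv := fun x => (hg (f x)).eq (hf x).symm
      right_inv := fun x => (hf (g x)).eq (hg x).symm }
  have he : Continuous e := by
    rw [continuous_iff_continuousAt]
    intro x U hU
    obtain ⟨m, -, hxm, hm⟩ := exists_mem_sdi_subset isOpen_interior
      (mem_interior_iff_mem_nhds.2 hU)
    obtain ⟨t, ht⟩ := exists_closedSupport_eq_sdi m
    have key : ∀ y, f y ∈ sdi m ↔ y ∈ closedSupport Cantor (σ.symm t) := fun y => by
      rw [← (hf y).mem_iff, σ.apply_symm_apply, ht]
    rw [Filter.mem_map]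
    filter_upwards [(isOpen_closedSupport (σ.symm t)).mem_nhds ((key x).1 hxm)] with y hy
    exact (interior_subset (hm ((key y).2 hy)) : f y ∈ U)
  refine ⟨he.homeoOfEquivCompactToT2, fun v x => ?_, fun v x => (hf x).mem_iff v⟩
  refine (hf (v • x)).eq fun k hk => ?_
  rw [mem_closedSupport_conj] at hk ⊢
  have := hf x _ hk
  rwa [map_mul, map_mul, map_inv] at this

end Spatial

/-! ### Loops supported on one dyadic interval -/

lemma mem_sdi_nil (x : Cantor) : x ∈ sdi [] := ⟨x, rfl⟩

section Bump

variable {Γ : Type*} [Group Γ]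

/-- By compactness a loop is constant on all intervals of some level; repeated halving then
assembles it from these pieces. -/
lemma loop_induction {a : LoopGroup Γ} {P : LoopGroup Γ → Prop}
    (mul : ∀ a b, P a → P b → P (a * b))
    (const : ∀ m g, P ((LocallyConstant.const Cantor g).mulIndicator (isClopen_sdi m))) :
    P a := by
  have hN : ∃ N : ℕ, ∀ m : List Bool, N ≤ m.length → (sdi m ∩ Set.univ).Nonempty →
      ∃ g, ∀ y ∈ sdi m, a y = g := by
    refine isCompact_univ.induction_on (p := fun S => ∃ N : ℕ, ∀ m : List Bool,
      N ≤ m.length → (sdi m ∩ S).Nonempty → ∃ g, ∀ y ∈ sdi m, a y = g) ?_ ?_ ?_ ?_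
    · exact ⟨0, fun m _ h => by simp at h⟩
    · rintro S S' hS ⟨N, hN⟩
      exact ⟨N, fun m hm h => hN m hm (h.mono (Set.inter_subset_inter_right _ hS))⟩
    · rintro S S' ⟨N, hN⟩ ⟨N', hN'⟩
      refine ⟨max N N', fun m hm ⟨x, hx, hxS⟩ => ?_⟩
      rcases hxS with hxS | hxS
      · exact hN m ((le_max_left _ _).trans hm) ⟨x, hx, hxS⟩
      · exact hN' m ((le_max_right _ _).trans hm) ⟨x, hx, hxS⟩
    · intro x _
      obtain ⟨U, hU, hxU, haU⟩ := a.isLocallyConstant.exists_open x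
      obtain ⟨w, -, hxw, hw⟩ := exists_mem_sdi_subset hU hxU
      refine ⟨sdi w, mem_nhdsWithin_of_mem_nhds ((isOpen_sdi w).mem_nhds hxw), w.length,
        fun m hm ⟨y, ⟨z, hz⟩, ⟨z', hz'⟩⟩ => ⟨a x, fun y hy => haU y (hw ?_)⟩⟩
      obtain ⟨r, rfl, -⟩ := prefix_of_app_eq (hz'.trans hz.symm) hm
      exact sdi_append_subset w r hy
  obtain ⟨N, hN⟩ := hN
  have key : ∀ (n : ℕ) (m : List Bool), m.length + n = N →
      P (a.mulIndicator (isClopen_sdi m)) := by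
    intro n
    induction n with
    | zero =>
      intro m hm
      obtain ⟨g, hg⟩ := hN m (by omega) ⟨app m fun _ => true, app_mem_sdi _ _, trivial⟩
      convert const m g using 1
      ext y
      by_cases hy : y ∈ sdi m
      · rw [LocallyConstant.mulIndicator_of_mem _ _ hy, LocallyConstant.mulIndicator_of_mem _ _ hy,
          hg y hy]
        rfl
      · rw [LocallyConstant.mulIndicator_of_notMem _ _ hy,
          LocallyConstant.mulIndicator_of_notMem _ _ hy]
    | succ n ih =>
      intro m hm
      convert mul _ _ (ih (m ++ [false]) (by simp; omega)) (ih (m ++ [true]) (by simp; omega))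
        using 1
      ext y
      have hd : Disjoint (sdi (m ++ [false])) (sdi (m ++ [true])) :=
        sdi_append_disjoint m (sdi_disjoint_of_head_ne (by decide) [] [])
      rw [LocallyConstant.mul_apply]
      by_cases hy : y ∈ sdi m
      · obtain ⟨z, rfl⟩ := hy
        obtain ⟨r, hr, z', rfl⟩ := exists_word 1 z
        obtain ⟨b, rfl⟩ := List.length_eq_one_iff.1 hr
        rw [LocallyConstant.mulIndicator_of_mem _ _ (app_mem_sdi _ _), ← app_append]
        cases b
        · rw [LocallyConstant.mulIndicator_of_mem _ _ (app_mem_sdi _ _),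
            LocallyConstant.mulIndicator_of_notMem _ _
              (Set.disjoint_left.1 hd (app_mem_sdi _ _)), mul_one]
        · rw [LocallyConstant.mulIndicator_of_mem _ _ (app_mem_sdi (m ++ [true]) _),
            LocallyConstant.mulIndicator_of_notMem _ _
              (Set.disjoint_right.1 hd (app_mem_sdi _ _)), one_mul]
      · rw [LocallyConstant.mulIndicator_of_notMem _ _ hy,
          LocallyConstant.mulIndicator_of_notMem _ _ fun h => hy (sdi_append_subset _ _ h),
          LocallyConstant.mulIndicator_of_notMem _ _ fun h => hy (sdi_append_subset _ _ h), mul_one]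
  convert key N [] (by simp) using 1
  ext y
  rw [LocallyConstant.mulIndicator_of_mem _ _ (mem_sdi_nil y)]

variable (α₀ α₁ : MulAut Γ)

/-- The loop with value `α_m⁻¹ k` on the sequences with prefix `m`, trivial elsewhere. -/
noncomputable def bump (m : List Bool) (k : Γ) : LoopGroup Γ :=
  (LocallyConstant.const Cantor ((wordAut α₀ α₁ m)⁻¹ k)).mulIndicator (isClopen_sdi m)

lemma bump_of_mem {m : List Bool} (k : Γ) {x : Cantor} (hx : x ∈ sdi m) :
    bump α₀ α₁ m k x = (wordAut α₀ α₁ m)⁻¹ k :=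
  LocallyConstant.mulIndicator_of_mem _ _ hx

lemma bump_of_notMem {m : List Bool} (k : Γ) {x : Cantor} (hx : x ∉ sdi m) :
    bump α₀ α₁ m k x = 1 :=
  LocallyConstant.mulIndicator_of_notMem _ _ hx

lemma bump_one (m : List Bool) : bump α₀ α₁ m 1 = 1 := by
  ext x
  by_cases hx : x ∈ sdi m
  · rw [bump_of_mem _ _ _ hx, map_one]; rfl
  · rw [bump_of_notMem _ _ _ hx]; rfl

lemma bump_mul (m : List Bool) (k l : Γ) :
    bump α₀ α₁ m (k * l) = bump α₀ α₁ m k * bump α₀ α₁ m l := by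
  ext x
  rw [LocallyConstant.mul_apply]
  by_cases hx : x ∈ sdi m
  · rw [bump_of_mem _ _ _ hx, bump_of_mem _ _ _ hx, bump_of_mem _ _ _ hx, map_mul]
  · rw [bump_of_notMem _ _ _ hx, bump_of_notMem _ _ _ hx, bump_of_notMem _ _ _ hx, mul_one]

lemma bump_nil (k : Γ) : bump α₀ α₁ [] k = LocallyConstant.const Cantor k := by
  ext x
  rw [bump_of_mem _ _ _ (mem_sdi_nil x)]
  simp [wordAut]

lemma bump_split (m : List Bool) (k : Γ) :
    bump α₀ α₁ m k = bump α₀ α₁ (m ++ [false]) (α₀ k) * bump α₀ α₁ (m ++ [true]) (α₁ k) := by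
  have hd : Disjoint (sdi (m ++ [false])) (sdi (m ++ [true])) :=
    sdi_append_disjoint m (sdi_disjoint_of_head_ne (by decide) [] [])
  ext x
  rw [LocallyConstant.mul_apply]
  by_cases hx : x ∈ sdi m
  · obtain ⟨z, rfl⟩ := hx
    obtain ⟨r, hr, z', rfl⟩ := exists_word 1 z
    obtain ⟨b, rfl⟩ := List.length_eq_one_iff.1 hr
    rw [bump_of_mem _ _ _ (app_mem_sdi _ _), ← app_append]
    cases b
    · rw [bump_of_mem _ _ _ (app_mem_sdi _ _),
        bump_of_notMem _ _ _ (Set.disjoint_left.1 hd (app_mem_sdi _ _)), wordAut_append]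
      simp [wordAut]
    · rw [bump_of_mem _ _ _ (app_mem_sdi (m ++ [true]) _),
        bump_of_notMem _ _ _ (Set.disjoint_right.1 hd (app_mem_sdi _ _)), wordAut_append]
      simp [wordAut]
  · rw [bump_of_notMem _ _ _ hx, bump_of_notMem _ _ _ fun h => hx (sdi_append_subset _ _ h),
      bump_of_notMem _ _ _ fun h => hx (sdi_append_subset _ _ h), mul_one]

lemma jonesAction_apply (v : thompsonV) (a : LoopGroup Γ) (x : Cantor) :
    jonesAction α₀ α₁ v a (v • x) = tau α₀ α₁ v x (a x) := act_apply α₀ α₁ v a x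

lemma smul_mem_sdi_iff {v : thompsonV} {m w : List Bool} (h : Adapted v.1 m w) {x : Cantor} :
    v • x ∈ sdi w ↔ x ∈ sdi m := by
  constructor
  · rintro ⟨z, hz⟩
    rw [← h z] at hz
    exact ⟨z, v.1.injective hz⟩
  · rintro ⟨z, rfl⟩
    exact ⟨z, (h z).symm⟩

/-- The factor α_m⁻¹ in `bump` is chosen for this: τ = α_w⁻¹ α_m turns it into α_w⁻¹, so `V` merely
relabels the interval. -/
lemma jonesAction_bump {v : thompsonV} {m w : List Bool} (h : Adapted v.1 m w) (k : Γ) :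
    jonesAction α₀ α₁ v (bump α₀ α₁ m k) = bump α₀ α₁ w k := by
  ext y
  obtain ⟨x, rfl⟩ := MulAction.surjective v y
  rw [jonesAction_apply]
  by_cases hx : x ∈ sdi m
  · rw [bump_of_mem _ _ _ hx, bump_of_mem _ _ _ ((smul_mem_sdi_iff h).2 hx), tau_eq α₀ α₁ v hx h]
    simp
  · rw [bump_of_notMem _ _ _ hx, bump_of_notMem _ _ _ fun h' => hx ((smul_mem_sdi_iff h).1 h'),
      map_one]

end Bump

/-! ### Equivariant isomorphisms of loop groups -/

/-- An isomorphism of loop groups that intertwines the action of `V` with a cocycle of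
automorphisms of `Δ`, the latter being inner at the points near which `v` is trivial. -/
structure LoopIso {Γ : Type*} [Group Γ] (α₀ α₁ : MulAut Γ) (Δ : Type*) [Group Δ] where
  /-- the isomorphism -/
  iso : LoopGroup Γ ≃* LoopGroup Δ
  /-- the cocycle -/
  twist : thompsonV → Cantor → MulAut Δ
  equivariant : ∀ v a x, iso (jonesAction α₀ α₁ v a) (v • x) = twist v x (iso a x)
  isInner : ∀ v x, x ∉ closedSupport Cantor v → IsInner (twist v x)

namespace LoopIso

variable {Γ Δ : Type*} [Group Γ] [Group Δ] {α₀ α₁ : MulAut Γ} (T : LoopIso α₀ α₁ Δ)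

lemma exists_iso_apply_eq (x : Cantor) (d : Δ) : ∃ a, T.iso a x = d :=
  ⟨T.iso.symm (LocallyConstant.const Cantor d), by simp⟩

lemma smul_eq_of_notMem {v : thompsonV} {x : Cantor} (h : x ∉ closedSupport Cantor v) :
    v • x = x := by
  by_contra hx
  exact h (subset_closure hx)

lemma ne_nil_of_notMem {m : List Bool} {x : Cantor} (h : x ∉ sdi m) : m ≠ [] := by
  rintro rfl
  exact h (mem_sdi_nil x)

lemma notMem_sdi_not (x : Cantor) : x ∉ sdi [!x 0] := by
  rintro ⟨z, hz⟩
  have : (!x 0) = x 0 := congrFun hz 0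
  simp at this

/-- Up to an inner correction, the value at `x` is also that of a loop supported on a second
interval disjoint from the first. Any `d` is the value of a product of two loops, each commuting
with one of the two representatives. -/
lemma commute_of_notMem {m : List Bool} {a : LoopGroup Γ} (ha : ∀ y ∉ sdi m, a y = 1)
    {x : Cantor} (hx : x ∉ sdi m) (d : Δ) : Commute (T.iso a x) d := by
  obtain ⟨b, m, rfl⟩ := List.exists_cons_of_ne_nil (ne_nil_of_notMem hx)
  have hb : b ≠ !b := by cases b <;> decide
  have hd := sdi_disjoint_of_head_ne hb m [!x 1]
  have hx' : x ∉ sdi [!b, !x 1] := by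
    rintro ⟨z, hz⟩
    have : (!x 1) = x 1 := congrFun hz 1
    simp at this
  obtain ⟨v, hv, hvx⟩ := exists_adapted_of_ne_nil (m := b :: m) (w := [!b, !x 1])
    (by simp) (by simp) x
  have hxv := hvx hx hx'
  obtain ⟨s, hs⟩ := T.isInner v x hxv
  obtain ⟨e, he⟩ := T.exists_iso_apply_eq x s
  obtain ⟨q, rfl⟩ := T.exists_iso_apply_eq x d
  have h1 := T.equivariant v a x
  rw [smul_eq_of_notMem hxv, hs, MulAut.conj_apply] at h1
  -- Conjugating by `e` cancels the inner twist at `x` without enlarging the support.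
  let a' := e⁻¹ * jonesAction α₀ α₁ v a * e
  have ha'x : T.iso a' x = T.iso a x := by
    simp only [a', map_mul, map_inv, LocallyConstant.mul_apply, LocallyConstant.inv_apply, h1, he]
    group
  have ha' : ∀ y ∉ sdi [!b, !x 1], a' y = 1 := by
    intro y hy
    obtain ⟨y, rfl⟩ := MulAction.surjective v y
    have : jonesAction α₀ α₁ v a (v • y) = 1 := by
      rw [jonesAction_apply, ha y fun h => hy ((smul_mem_sdi_iff hv).2 h), map_one]
    simp [a', LocallyConstant.mul_apply, this]
  let q₁ := q.mulIndicator (isClopen_sdi (b :: m))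
  let q₂ := q.mulIndicator (isClopen_sdi (b :: m)).compl
  have hq : q = q₁ * q₂ := by
    ext y
    rw [LocallyConstant.mul_apply]
    by_cases hy : y ∈ sdi (b :: m)
    · rw [LocallyConstant.mulIndicator_of_mem _ _ hy,
        LocallyConstant.mulIndicator_of_notMem _ _ (by simpa using hy), mul_one]
    · rw [LocallyConstant.mulIndicator_of_notMem _ _ hy,
        LocallyConstant.mulIndicator_of_mem _ _ (by simpa using hy), one_mul]
  have hc₂ : Commute a q₂ := by
    ext y
    rw [LocallyConstant.mul_apply, LocallyConstant.mul_apply]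
    by_cases hy : y ∈ sdi (b :: m)
    · rw [LocallyConstant.mulIndicator_of_notMem _ _ (by simpa using hy), mul_one, one_mul]
    · rw [ha y hy, mul_one, one_mul]
  have hc₁ : Commute a' q₁ := by
    ext y
    rw [LocallyConstant.mul_apply a', LocallyConstant.mul_apply q₁]
    by_cases hy : y ∈ sdi (b :: m)
    · rw [ha' y (Set.disjoint_left.1 hd hy), mul_one, one_mul]
    · rw [LocallyConstant.mulIndicator_of_notMem _ _ hy, mul_one, one_mul]
  have ev : ∀ {c c' : LoopGroup Γ}, Commute c c' → Commute (T.iso c x) (T.iso c' x) :=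
    fun {c c'} h => by
      have := congrArg (fun f : LoopGroup Δ => f x) (congrArg T.iso h.eq)
      rwa [map_mul, map_mul] at this
  rw [hq, map_mul, LocallyConstant.mul_apply]
  exact (ha'x ▸ ev hc₁).mul_right (ev hc₂)

/-- The value at `x` of the image of a loop supported on an interval not containing `x`. -/
noncomputable def outer (x : Cantor) : Γ →* Δ where
  toFun k := T.iso (bump α₀ α₁ [!x 0] k) x
  map_one' := by rw [bump_one, map_one]; rfl
  map_mul' k l := by rw [bump_mul, map_mul]; rfl

lemma outer_apply (x : Cantor) (k : Γ) : T.outer x k = T.iso (bump α₀ α₁ [!x 0] k) x := rfl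

lemma commute_outer (x : Cantor) (k : Γ) (d : Δ) : Commute (T.outer x k) d :=
  T.commute_of_notMem (fun _ hy => bump_of_notMem _ _ _ hy) (notMem_sdi_not x) d

/-- An element trivial near `x` carries one interval to the other; its twist at `x` is inner, so it
fixes the central value. -/
lemma iso_bump_of_notMem {m : List Bool} {x : Cantor} (hx : x ∉ sdi m) (k : Γ) :
    T.iso (bump α₀ α₁ m k) x = T.outer x k := by
  obtain ⟨v, hv, hvx⟩ := exists_adapted_of_ne_nil (ne_nil_of_notMem hx)
    (w := [!x 0]) (by simp) x
  have hxv := hvx hx (notMem_sdi_not x)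
  obtain ⟨s, hs⟩ := T.isInner v x hxv
  have h := T.equivariant v (bump α₀ α₁ m k) x
  rw [jonesAction_bump α₀ α₁ hv, smul_eq_of_notMem hxv, hs, MulAut.conj_apply,
    ← (T.commute_of_notMem (fun _ hy => bump_of_notMem _ _ _ hy) hx s).eq,
    mul_inv_cancel_right] at h
  exact h.symm

lemma outer_split (x : Cantor) (k : Γ) :
    T.outer x k = T.outer x (α₀ k) * T.outer x (α₁ k) := by
  rw [outer_apply, bump_split, map_mul, LocallyConstant.mul_apply, T.iso_bump_of_notMem,
    T.iso_bump_of_notMem] <;>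
  exact fun h => notMem_sdi_not x (sdi_append_subset _ _ h)

lemma outer_smul (v : thompsonV) (x : Cantor) (k : Γ) :
    T.outer (v • x) k = T.twist v x (T.outer x k) := by
  obtain ⟨N, hN⟩ := IsThompson.level v.2
  -- Any word starting with `!x 0` avoids `x`; the padding makes it long enough for `v` to exchange
  -- it for some `w`.
  let m := (!x 0) :: List.replicate N true
  have hx : x ∉ sdi m := fun h => notMem_sdi_not x (sdi_append_subset [!x 0] _ h)
  obtain ⟨w, hw⟩ := hN m (by simp [m])
  have h := T.equivariant v (bump α₀ α₁ m k) x
  rwa [jonesAction_bump α₀ α₁ hw, T.iso_bump_of_notMem hx,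
    T.iso_bump_of_notMem fun h => hx ((smul_mem_sdi_iff hw).1 h)] at h

lemma isLocallyConstant_outer (k : Γ) : IsLocallyConstant fun x => T.outer x k := by
  rw [IsLocallyConstant.iff_eventually_eq]
  intro x
  have h := (IsLocallyConstant.iff_eventually_eq _).1
    (T.iso (bump α₀ α₁ [!x 0] k)).isLocallyConstant x
  filter_upwards [h, (isClopen_sdi [!x 0]).1.isOpen_compl.mem_nhds (notMem_sdi_not x)]
    with y hy hyx
  rw [← T.iso_bump_of_notMem hyx k]
  exact hy

/-- The isomorphism at the point `x`, corrected by the contribution of outer loops. -/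
noncomputable def localHom (x : Cantor) : Γ →* Δ where
  toFun g := T.iso (LocallyConstant.const Cantor g) x * (T.outer x g)⁻¹
  map_one' := by
    rw [← bump_nil α₀ α₁, bump_one, map_one, map_one, inv_one, mul_one]; rfl
  map_mul' g h := by
    rw [← bump_nil α₀ α₁, bump_mul, bump_nil, bump_nil, map_mul, map_mul,
      LocallyConstant.mul_apply, mul_inv_rev, mul_assoc, mul_assoc,
      ← ((T.commute_outer x g _).inv_left).eq, ((T.commute_outer x g _).inv_left).left_comm]

lemma localHom_apply (x : Cantor) (g : Γ) :
    T.localHom x g = T.iso (LocallyConstant.const Cantor g) x * (T.outer x g)⁻¹ := rfl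

/-- Halving an interval around `x` splits off a half not containing `x`, whose contribution is an
`outer` value and cancels against `outer_split`. So the correction makes `localHom` local at `x`. -/
lemma localHom_eq {m : List Bool} {x : Cantor} (hx : x ∈ sdi m) (g : Γ) :
    T.localHom x g = T.iso (bump α₀ α₁ m (wordAut α₀ α₁ m g)) x *
      (T.outer x (wordAut α₀ α₁ m g))⁻¹ := by
  induction m using List.reverseRecOn with
  | nil => rw [bump_nil]; rfl
  | append_singleton m b ih =>
    rw [ih (sdi_append_subset _ _ hx), bump_split, outer_split, map_mul,
      LocallyConstant.mul_apply, wordAut_append]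
    have hd : Disjoint (sdi (m ++ [false])) (sdi (m ++ [true])) :=
      sdi_append_disjoint m (sdi_disjoint_of_head_ne (by decide) [] [])
    cases b
    · rw [T.iso_bump_of_notMem (Set.disjoint_left.1 hd hx)]
      simp [wordAut, mul_assoc]
    · rw [T.iso_bump_of_notMem (Set.disjoint_right.1 hd hx), mul_inv_rev, ← mul_assoc,
        (T.commute_outer x _ _).eq]
      simp only [wordAut, cond_true, one_mul, MulAut.mul_apply, mul_assoc]
      rw [← ((T.commute_outer x (α₀ (wordAut α₀ α₁ m g)) _).inv_left).eq, mul_inv_cancel_left]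

lemma localHom_smul (v : thompsonV) (x : Cantor) (g : Γ) :
    T.localHom (v • x) (tau α₀ α₁ v x g) = T.twist v x (T.localHom x g) := by
  obtain ⟨⟨m, w⟩, hx, hv⟩ := exists_adapted v x
  have hw : wordAut α₀ α₁ w (tau α₀ α₁ v x g) = wordAut α₀ α₁ m g := by
    rw [tau_eq α₀ α₁ v hx hv]; simp
  rw [T.localHom_eq hx, T.localHom_eq ((smul_mem_sdi_iff hv).2 hx), hw, outer_smul, map_mul,
    map_inv, ← T.equivariant, jonesAction_bump α₀ α₁ hv]

/-- If `g` is killed at `x`, it is killed on an interval around `x`, so the image of the bump there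
is `y ↦ T.outer y k` everywhere. That function is equivariant, so the bump on a disjoint interval
has the same image, which forces `k = 1`. -/
lemma localHom_injective (x : Cantor) : Function.Injective (T.localHom x) := by
  rw [injective_iff_map_eq_one]
  intro g hg
  have h := ((IsLocallyConstant.iff_eventually_eq _).1
    (T.iso (LocallyConstant.const Cantor g)).isLocallyConstant x).and
      ((IsLocallyConstant.iff_eventually_eq _).1 (T.isLocallyConstant_outer g) x)
  obtain ⟨U, hU, hUo, hxU⟩ := eventually_nhds_iff.1 h
  obtain ⟨m, hm, hxm, hmU⟩ := exists_mem_sdi_subset hUo hxU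
  let k := wordAut α₀ α₁ m g
  have hk : ∀ y, T.iso (bump α₀ α₁ m k) y = T.outer y k := by
    intro y
    by_cases hy : y ∈ sdi m
    · have h1 := T.localHom_eq hy g
      have h2 : T.localHom y g = T.localHom x g := by
        have h3 : T.iso (LocallyConstant.const Cantor g) y =
            T.iso (LocallyConstant.const Cantor g) x := (hU y (hmU hy)).1
        rw [localHom_apply, localHom_apply, h3, (hU y (hmU hy)).2]
      rw [h2, hg] at h1
      exact (mul_inv_eq_one.1 h1.symm)
    · exact T.iso_bump_of_notMem hy k
  obtain ⟨b, m, rfl⟩ := List.exists_cons_of_ne_nil hm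
  obtain ⟨v, hv, -⟩ := exists_adapted_of_ne_nil (m := b :: m) (w := [!b]) (by simp) (by simp) x
  have heq : bump α₀ α₁ [!b] k = bump α₀ α₁ (b :: m) k := by
    apply T.iso.injective
    ext y
    obtain ⟨y, rfl⟩ := MulAction.surjective v y
    rw [hk, ← jonesAction_bump α₀ α₁ hv, T.equivariant, hk, outer_smul]
  have hb : b ≠ !b := by cases b <;> decide
  have h1 := congrArg (fun f : LoopGroup Γ => f x) heq
  rw [bump_of_mem _ _ _ hxm, bump_of_notMem _ _ _
    (Set.disjoint_left.1 (sdi_disjoint_of_head_ne hb m []) hxm)] at h1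
  simpa [k] using h1.symm

/-- A loop fixed by the action of `V` is a constant fixed by `α₀` and `α₁`. -/
lemma eq_const_of_fixed {a : LoopGroup Γ} (ha : ∀ v, jonesAction α₀ α₁ v a = a) :
    ∃ k, a = LocallyConstant.const Cantor k ∧ α₀ k = k ∧ α₁ k = k := by
  let x : Cantor := fun _ => true
  obtain ⟨U, hU, hxU, haU⟩ := a.isLocallyConstant.exists_open x
  obtain ⟨m, hm, hxm, hmU⟩ := exists_mem_sdi_subset hU hxU
  have hmx : ∀ z, a (app m z) = a x := fun z => haU _ (hmU (app_mem_sdi m z))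
  -- Untwisted by α_w, the value on an interval does not depend on the interval, as `V` is
  -- transitive on proper ones.
  have key : ∀ w, w ≠ [] → ∀ z,
      wordAut α₀ α₁ w (a (app w z)) = wordAut α₀ α₁ m (a x) := by
    intro w hw z
    obtain ⟨v, hv, -⟩ := exists_adapted_of_ne_nil hm hw x
    have h := jonesAction_apply α₀ α₁ v a (app m z)
    have hvz : v • app m z = app w z := hv z
    rw [ha, hvz, tau_eq α₀ α₁ v (app_mem_sdi m z) hv, hmx] at h
    rw [h]
    simp
  have hfix : ∀ b, wordAut α₀ α₁ [b] (wordAut α₀ α₁ m (a x)) = wordAut α₀ α₁ m (a x) := by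
    intro b
    have h := key (m ++ [b]) (by simp) x
    rwa [app_append, hmx, wordAut_append] at h
  have h₀ : α₀ (wordAut α₀ α₁ m (a x)) = wordAut α₀ α₁ m (a x) := by
    simpa [wordAut] using hfix false
  have h₁ : α₁ (wordAut α₀ α₁ m (a x)) = wordAut α₀ α₁ m (a x) := by
    simpa [wordAut] using hfix true
  refine ⟨_, ?_, h₀, h₁⟩
  ext y
  obtain ⟨w, hw, z, rfl⟩ := exists_word 1 y
  obtain ⟨b, rfl⟩ := List.length_eq_one_iff.1 hw
  apply (wordAut α₀ α₁ [b]).injective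
  rw [key [b] (by simp)]
  exact (hfix b).symm

/-- The loop `y ↦ T.outer y k` has a `V`-fixed preimage, hence a constant `l` fixed by both twists.
Then `outer_split` makes `T.outer x l` idempotent, so trivial, and `T.localHom x l` is the value
sought. -/
lemma outer_mem_range (x : Cantor) (k : Γ) : T.outer x k ∈ (T.localHom x).range := by
  let a := T.iso.symm ⟨fun y => T.outer y k, T.isLocallyConstant_outer k⟩
  have hax : ∀ y, T.iso a y = T.outer y k := fun y => by simp [a]
  have ha : ∀ v, jonesAction α₀ α₁ v a = a := by
    intro v
    apply T.iso.injective
    ext y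
    obtain ⟨y, rfl⟩ := MulAction.surjective v y
    rw [T.equivariant, hax, hax, outer_smul]
  obtain ⟨l, hl, h₀, h₁⟩ := eq_const_of_fixed ha
  have hF : T.outer x l = 1 := by
    have h := T.outer_split x l
    rw [h₀, h₁] at h
    exact left_eq_mul.1 h
  exact ⟨l, by rw [localHom_apply, hF, ← hl, hax, inv_one, mul_one]⟩

/-- Loops are products of bumps, and the value of a bump's image at `x` is a `localHom` value times
an `outer` value, or just an `outer` value. -/
lemma localHom_surjective (x : Cantor) : Function.Surjective (T.localHom x) := by
  intro d
  obtain ⟨a, rfl⟩ := T.exists_iso_apply_eq x d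
  change T.iso a x ∈ (T.localHom x).range
  refine loop_induction (P := fun a => T.iso a x ∈ (T.localHom x).range) ?_ ?_
  · intro a b ha hb
    rw [map_mul]
    exact mul_mem ha hb
  · intro m g
    have hb : (LocallyConstant.const Cantor g).mulIndicator (isClopen_sdi m) =
        bump α₀ α₁ m (wordAut α₀ α₁ m g) := by simp [bump]
    rw [hb]
    by_cases hx : x ∈ sdi m
    · rw [← eq_mul_inv_iff_mul_eq.1 (T.localHom_eq hx g)]
      exact mul_mem ⟨g, rfl⟩ (T.outer_mem_range x _)
    · rw [T.iso_bump_of_notMem hx]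
      exact T.outer_mem_range x _

/-- The isomorphism `Γ ≃* Δ` induced at the point `x`. -/
noncomputable def localIso (x : Cantor) : Γ ≃* Δ :=
  MulEquiv.ofBijective (T.localHom x) ⟨T.localHom_injective x, T.localHom_surjective x⟩

lemma localIso_smul (v : thompsonV) (x : Cantor) (g : Γ) :
    T.localIso (v • x) (tau α₀ α₁ v x g) = T.twist v x (T.localIso x g) :=
  T.localHom_smul v x g

end LoopIso

/-! ### Isomorphisms of fraction groups -/

section Iso

variable {Γ Δ : Type*} [Group Γ] [Group Δ] {α₀ α₁ : MulAut Γ} {β₀ β₁ : MulAut Δ}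

/-- The loops that are trivial outside of `sdi m`. -/
def loopsOn (Γ : Type*) [Group Γ] (m : List Bool) : Subgroup (LoopGroup Γ) where
  carrier := {a | ∀ y ∉ sdi m, a y = 1}
  one_mem' _ _ := rfl
  mul_mem' ha hb y hy := by rw [LocallyConstant.mul_apply, ha y hy, hb y hy, mul_one]
  inv_mem' ha y hy := by rw [LocallyConstant.inv_apply, ha y hy, inv_one]

lemma jonesAction_mem_loopsOn {v : thompsonV} {m w : List Bool} (h : Adapted v.1 m w)
    {a : LoopGroup Γ} (ha : a ∈ loopsOn Γ m) : jonesAction α₀ α₁ v a ∈ loopsOn Γ w := by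
  intro y hy
  obtain ⟨y, rfl⟩ := MulAction.surjective v y
  rw [jonesAction_apply, ha y fun h' => hy ((smul_mem_sdi_iff h).2 h'), map_one]

lemma exists_mul_loopsOn (a : LoopGroup Γ) :
    ∃ b ∈ loopsOn Γ [false], ∃ c ∈ loopsOn Γ [true], a = b * c := by
  refine ⟨a.mulIndicator (isClopen_sdi _),
    fun y hy => LocallyConstant.mulIndicator_of_notMem _ _ hy, a.mulIndicator (isClopen_sdi _),
    fun y hy => LocallyConstant.mulIndicator_of_notMem _ _ hy, ?_⟩
  have hd : Disjoint (sdi [false]) (sdi [true]) := sdi_disjoint_of_head_ne (by decide) [] []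
  ext y
  rw [LocallyConstant.mul_apply]
  obtain ⟨w, hw, z, rfl⟩ := exists_word 1 y
  obtain ⟨b, rfl⟩ := List.length_eq_one_iff.1 hw
  cases b
  · rw [LocallyConstant.mulIndicator_of_mem _ _ (app_mem_sdi _ _),
      LocallyConstant.mulIndicator_of_notMem _ _ (Set.disjoint_left.1 hd (app_mem_sdi _ _)),
      mul_one]
  · rw [LocallyConstant.mulIndicator_of_notMem _ _ (Set.disjoint_right.1 hd (app_mem_sdi _ _)),
      LocallyConstant.mulIndicator_of_mem _ _ (app_mem_sdi _ _), one_mul]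

lemma commute_of_mem_loopsOn {m w : List Bool} (hd : Disjoint (sdi m) (sdi w))
    {a b : LoopGroup Γ} (ha : a ∈ loopsOn Γ m) (hb : b ∈ loopsOn Γ w) : Commute a b := by
  ext y
  rw [LocallyConstant.mul_apply, LocallyConstant.mul_apply]
  by_cases hy : y ∈ sdi m
  · rw [hb y (Set.disjoint_left.1 hd hy), mul_one, one_mul]
  · rw [ha y hy, mul_one, one_mul]

/-- Isomorphisms of fraction groups preserve the loop groups. -/
theorem right_map_inl (θ : FractionGroup α₀ α₁ ≃* FractionGroup β₀ β₁) (a : LoopGroup Γ) :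
    (θ (inl a)).right = 1 := by
  let ψ : LoopGroup Γ →* thompsonV := rightHom.comp (θ.toMonoidHom.comp inl)
  have hM : ψ.range.Normal := by
    constructor
    rintro _ ⟨a, rfl⟩ g
    let x := θ.symm (inr g)
    refine ⟨x.left * jonesAction α₀ α₁ x.right a * x.left⁻¹, ?_⟩
    have hx : (inl (x.left * jonesAction α₀ α₁ x.right a * x.left⁻¹) : FractionGroup α₀ α₁) =
        x * inl a * x⁻¹ := by
      conv_rhs => rw [← inl_left_mul_inr_right x]
      rw [map_mul, map_mul, inl_aut, map_inv, map_inv]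
      group
    change rightHom (θ (inl _)) = g * rightHom (θ (inl a)) * g⁻¹
    rw [hx]
    simp [x]
  have hbot := thompsonV_eq_bot_or_eq_bot (M₁ := (loopsOn Γ [false]).map ψ)
    (M₂ := (loopsOn Γ [true]).map ψ) hM (Subgroup.map_le_range _ _) (by
      rintro _ ⟨c, rfl⟩ _ ⟨d, hd, rfl⟩
      refine ⟨c * d * c⁻¹, fun y hy => ?_, by simp⟩
      rw [LocallyConstant.mul_apply, LocallyConstant.mul_apply, hd y hy, mul_one,
        LocallyConstant.inv_apply, mul_inv_cancel]) (by
      rintro _ ⟨c, hc, rfl⟩ _ ⟨d, hd, rfl⟩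
      exact (commute_of_mem_loopsOn (sdi_disjoint_of_head_ne (by decide) [] []) hc hd).map ψ)
  -- Conjugating by the image of an element of `V` carrying one interval onto the other spreads
  -- triviality to both halves.
  have htrans : ∀ b c : Bool, (loopsOn Γ [b]).map ψ = ⊥ → ∀ a ∈ loopsOn Γ [c], ψ a = 1 := by
    intro b c h a ha
    obtain ⟨v, hv, -⟩ := exists_adapted_of_ne_nil (m := [c]) (w := [b]) (by simp) (by simp)
      fun _ => true
    have h1 : ψ (jonesAction α₀ α₁ v a) = 1 := by
      rw [← Subgroup.mem_bot, ← h]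
      exact ⟨_, jonesAction_mem_loopsOn hv ha, rfl⟩
    have h2 : ψ (jonesAction α₀ α₁ v a) =
        rightHom (θ (inr v)) * ψ a * (rightHom (θ (inr v)))⁻¹ := by
      change rightHom (θ (inl _)) = _ * rightHom (θ (inl a)) * _
      rw [inl_aut]
      simp
    rw [h2] at h1
    simpa using h1
  have hall : ∀ c : Bool, ∀ a ∈ loopsOn Γ [c], ψ a = 1 := by
    rcases hbot with h | h
    · exact fun c => htrans false c h
    · exact fun c => htrans true c h
  obtain ⟨b, hb, c, hc, rfl⟩ := exists_mul_loopsOn a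
  change ψ (b * c) = 1
  rw [map_mul, hall _ b hb, hall _ c hc, mul_one]

lemma right_map (θ : FractionGroup α₀ α₁ ≃* FractionGroup β₀ β₁) (x : FractionGroup α₀ α₁) :
    (θ x).right = (θ (inr x.right)).right := by
  conv_lhs => rw [← inl_left_mul_inr_right x]
  rw [map_mul, mul_right, right_map_inl, one_mul]

lemma map_inl (θ : FractionGroup α₀ α₁ ≃* FractionGroup β₀ β₁) (a : LoopGroup Γ) :
    θ (inl a) = inl (θ (inl a)).left := by
  ext1
  · rfl
  · exact right_map_inl θ a

/-- The automorphism of `V` induced by an isomorphism of fraction groups. -/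
noncomputable def inducedAut (θ : FractionGroup α₀ α₁ ≃* FractionGroup β₀ β₁) : thompsonV ≃* thompsonV where
  toFun v := (θ (inr v)).right
  invFun v := (θ.symm (inr v)).right
  left_inv v := by beta_reduce; rw [← right_map θ.symm]; simp
  right_inv v := by beta_reduce; rw [← right_map θ]; simp
  map_mul' v w := by rw [map_mul, map_mul, mul_right]

/-- The isomorphism of loop groups induced by an isomorphism of fraction groups. -/
noncomputable def inducedIso (θ : FractionGroup α₀ α₁ ≃* FractionGroup β₀ β₁) :
    LoopGroup Γ ≃* LoopGroup Δ where
  toFun a := (θ (inl a)).left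
  invFun a := (θ.symm (inl a)).left
  left_inv a := by beta_reduce; rw [← map_inl θ, θ.symm_apply_apply]; rfl
  right_inv a := by beta_reduce; rw [← map_inl θ.symm, θ.apply_symm_apply]; rfl
  map_mul' a b := by
    rw [map_mul, map_mul, mul_left, right_map_inl, map_one]
    rfl

/-- Apply θ to the relation that defines the semidirect product and compare loop components. -/
lemma inducedIso_jonesAction (θ : FractionGroup α₀ α₁ ≃* FractionGroup β₀ β₁) (v : thompsonV)
    (a : LoopGroup Γ) : inducedIso θ (jonesAction α₀ α₁ v a) =
      (θ (inr v)).left * jonesAction β₀ β₁ (inducedAut θ v) (inducedIso θ a) *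
        (θ (inr v)).left⁻¹ := by
  have h : θ (inl (jonesAction α₀ α₁ v a)) * θ (inr v) = θ (inr v) * θ (inl a) := by
    rw [← map_mul, ← map_mul, inl_aut]
    simp
  have h' := congrArg SemidirectProduct.left h
  rw [mul_left, mul_left, right_map_inl, map_one, MulAut.one_apply] at h'
  exact eq_mul_inv_of_mul_eq h'

lemma tau_eq_one_of_notMem {v : thompsonV} {x : Cantor} (h : x ∉ closedSupport Cantor v) :
    tau α₀ α₁ v x = 1 := by
  obtain ⟨U, hU, hUo, hxU⟩ := eventually_nhds_iff.1 (notMem_closedSupport_iff.1 h)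
  obtain ⟨m, -, hxm, hm⟩ := exists_mem_sdi_subset hUo hxU
  rw [tau_eq α₀ α₁ v (m := m) (w := m) hxm fun z => hU _ (hm (app_mem_sdi m z)),
    inv_mul_cancel]

/-- An isomorphism of fraction groups induces an equivariant isomorphism of loop groups whose
cocycle differs from the one of the target by inner automorphisms. -/
theorem exists_loopIso (θ : FractionGroup α₀ α₁ ≃* FractionGroup β₀ β₁) :
    ∃ T : LoopIso α₀ α₁ Δ, ∀ v x, ∃ d w y, T.twist v x = MulAut.conj d * tau β₀ β₁ w y := by
  obtain ⟨φ, hφ, hφs⟩ := exists_homeomorph_of_mulEquiv (inducedAut θ)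
  let C : LoopGroup Δ ≃* LoopGroup Δ :=
    { LocallyConstant.congrLeft φ.symm with map_mul' := fun _ _ => rfl }
  have hC : ∀ a x, C a x = a (φ x) := fun a x => rfl
  -- The loop component of `θ (inr v)` contributes the inner factor. Since φ matches supports, the
  -- factor τ is trivial where `v` is locally trivial.
  refine ⟨⟨(inducedIso θ).trans C, fun v x => MulAut.conj ((θ (inr v)).left (φ (v • x))) *
    tau β₀ β₁ (inducedAut θ v) (φ x), fun v a x => ?_, fun v x hx => ?_⟩,
    fun v x => ⟨_, _, _, rfl⟩⟩
  · rw [MulEquiv.trans_apply, MulEquiv.trans_apply, hC, hC, inducedIso_jonesAction,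
      LocallyConstant.mul_apply, LocallyConstant.mul_apply, LocallyConstant.inv_apply, hφ,
      jonesAction_apply]
    rfl
  · exact ⟨_, by rw [tau_eq_one_of_notMem ((hφs v x).not.2 hx), mul_one]⟩

end Iso

/-! ### Inner automorphisms -/

section Inner

variable {Γ : Type*} [Group Γ]

lemma isInner_iff {α : MulAut Γ} : IsInner α ↔ α ∈ (MulAut.conj : Γ →* MulAut Γ).range :=
  ⟨fun ⟨g, hg⟩ => ⟨g, hg.symm⟩, fun ⟨g, hg⟩ => ⟨g, hg.symm⟩⟩

lemma isInner_wordAut {α₀ α₁ : MulAut Γ} (h₀ : IsInner α₀) (h₁ : IsInner α₁) (m : List Bool) :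
    IsInner (wordAut α₀ α₁ m) := by
  rw [isInner_iff] at *
  induction m with
  | nil => exact one_mem _
  | cons b m ih =>
    refine mul_mem ih ?_
    cases b
    exacts [h₀, h₁]

lemma isInner_tau {α₀ α₁ : MulAut Γ} (h₀ : IsInner α₀) (h₁ : IsInner α₁) (v : thompsonV)
    (x : Cantor) : IsInner (tau α₀ α₁ v x) := by
  have := isInner_wordAut h₀ h₁
  simp only [isInner_iff] at *
  exact mul_mem (inv_mem (this _)) (this _)

lemma isInner_of_mulEquiv {Δ : Type*} [Group Δ] {α : MulAut Γ} {β : MulAut Δ} (κ : Γ ≃* Δ)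
    (hβ : IsInner β) (h : ∀ g, κ (α g) = β (κ g)) : IsInner α := by
  obtain ⟨d, rfl⟩ := hβ
  refine ⟨κ.symm d, MulEquiv.ext fun g => κ.injective ?_⟩
  rw [h]
  simp

/-- At a fixed point of `v`, `localIso_smul` says that the local isomorphism conjugates τ into the
twist, so τ is inner if the twist is. The constant sequence b under a dilation yields α_b. -/
theorem isInner_of_mulEquiv_fractionGroup {Δ : Type*} [Group Δ] {α₀ α₁ : MulAut Γ}
    {β₀ β₁ : MulAut Δ} (θ : FractionGroup α₀ α₁ ≃* FractionGroup β₀ β₁)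
    (h₀ : IsInner β₀) (h₁ : IsInner β₁) : IsInner α₀ ∧ IsInner α₁ := by
  obtain ⟨T, hT⟩ := exists_loopIso θ
  have key : ∀ b : Bool, IsInner (bif b then α₁ else α₀) := by
    intro b
    obtain ⟨v, hv, -⟩ := exists_dilation [] b
    let x : Cantor := fun _ => b
    have hx : ∀ m, m = List.replicate m.length b → app m x = x := by
      intro m
      induction m with
      | nil => exact fun _ => rfl
      | cons c m ih =>
        intro hm
        rw [List.length_cons, List.replicate_succ, List.cons.injEq] at hm
        funext n
        cases n with
        | zero => exact hm.1
        | succ n => exact congrFun (ih hm.2) n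
    have hvx : v • x = x := by
      have := hv x
      rwa [hx _ (by simp), hx _ (by simp)] at this
    have hτ : tau α₀ α₁ v x = (bif b then α₁ else α₀)⁻¹ := by
      rw [tau_eq α₀ α₁ v (m := [b]) (w := [b, b]) ⟨x, hx _ (by simp)⟩ hv]
      simp [wordAut]
    have htw : IsInner (T.twist v x) := by
      obtain ⟨d, w, y, h⟩ := hT v x
      have hy := isInner_tau h₀ h₁ w y
      rw [isInner_iff] at hy ⊢
      exact h ▸ mul_mem ⟨d, rfl⟩ hy
    have hinv : IsInner (tau α₀ α₁ v x) := isInner_of_mulEquiv (T.localIso x) htw fun g => by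
      rw [← T.localIso_smul, hvx]
    rw [hτ, isInner_iff, inv_mem_iff] at hinv
    exact isInner_iff.2 hinv
  exact ⟨key false, key true⟩

/-! ### Untwisting inner automorphisms -/

/-- The product `g_{l_n} ⋯ g_{l_1}` for a word `l_1 ⋯ l_n`. -/
def wordProd (g₀ g₁ : Γ) : List Bool → Γ
  | [] => 1
  | b :: m => wordProd g₀ g₁ m * bif b then g₁ else g₀

lemma wordProd_append (g₀ g₁ : Γ) (m w : List Bool) :
    wordProd g₀ g₁ (m ++ w) = wordProd g₀ g₁ w * wordProd g₀ g₁ m := by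
  induction m with
  | nil => simp [wordProd]
  | cons b m ih => simp [wordProd, ih, mul_assoc]

lemma wordAut_conj (g₀ g₁ : Γ) (m : List Bool) :
    wordAut (MulAut.conj g₀) (MulAut.conj g₁) m = MulAut.conj (wordProd g₀ g₁ m) := by
  induction m with
  | nil => simp [wordProd, wordAut]
  | cons b m ih => cases b <;> simp [wordProd, wordAut, ih]

/-- The cocycle `g_w⁻¹ g_m`, where `v` exchanges the prefix `m` of `x` for `w`. -/
noncomputable def wordCocycle (g₀ g₁ : Γ) (v : thompsonV) (x : Cantor) : Γ :=
  (wordProd g₀ g₁ (exists_adapted v x).choose.2)⁻¹ *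
    wordProd g₀ g₁ (exists_adapted v x).choose.1

lemma wordCocycle_eq (g₀ g₁ : Γ) (v : thompsonV) {x : Cantor} {m w : List Bool}
    (hx : x ∈ sdi m) (h : Adapted v.1 m w) :
    wordCocycle g₀ g₁ v x = (wordProd g₀ g₁ w)⁻¹ * wordProd g₀ g₁ m := by
  have key : ∀ {m w m' w' : List Bool}, x ∈ sdi m → Adapted v.1 m w → x ∈ sdi m' →
      Adapted v.1 m' w' → m.length ≤ m'.length →
      (wordProd g₀ g₁ w')⁻¹ * wordProd g₀ g₁ m' = (wordProd g₀ g₁ w)⁻¹ * wordProd g₀ g₁ m := by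
    rintro m w m' w' ⟨z, rfl⟩ h ⟨z', hz'⟩ h' hl
    obtain ⟨r, rfl, -⟩ := prefix_of_app_eq hz'.symm hl
    have hw : w' = w ++ r := eq_of_app_eq fun y => by
      rw [← h' y, app_append, app_append, h]
    rw [hw, wordProd_append, wordProd_append]
    group
  have hc := (exists_adapted v x).choose_spec
  rcases le_total m.length (exists_adapted v x).choose.1.length with hl | hl
  · exact key hx h hc.1 hc.2 hl
  · exact (key hc.1 hc.2 hx h hl).symm

lemma wordCocycle_mul (g₀ g₁ : Γ) (w v : thompsonV) (x : Cantor) :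
    wordCocycle g₀ g₁ (w * v) x = wordCocycle g₀ g₁ w (v • x) * wordCocycle g₀ g₁ v x := by
  obtain ⟨⟨m, u⟩, ⟨z, hz⟩, hv⟩ := exists_adapted v x
  obtain ⟨N, hN⟩ := IsThompson.level w.2
  obtain ⟨r, hr, y, rfl⟩ := exists_word N z
  obtain ⟨t, ht⟩ := hN (u ++ r) (by simp [hr])
  have hx : x ∈ sdi (m ++ r) := ⟨y, by rw [app_append]; exact hz⟩
  have hv' : Adapted v.1 (m ++ r) (u ++ r) := fun a => by
    rw [app_append, app_append]; exact hv _
  have hwv : Adapted (w * v).1 (m ++ r) t := fun a => by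
    rw [← ht a, ← hv' a]; rfl
  rw [wordCocycle_eq g₀ g₁ _ hx hwv, wordCocycle_eq g₀ g₁ _ ((smul_mem_sdi_iff hv').2 hx) ht,
    wordCocycle_eq g₀ g₁ _ hx hv']
  group

lemma tau_conj (g₀ g₁ : Γ) (v : thompsonV) (x : Cantor) :
    tau (MulAut.conj g₀) (MulAut.conj g₁) v x = MulAut.conj (wordCocycle g₀ g₁ v x) := by
  obtain ⟨⟨m, w⟩, hx, h⟩ := exists_adapted v x
  rw [tau_eq _ _ v hx h, wordCocycle_eq g₀ g₁ v hx h, wordAut_conj, wordAut_conj]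
  simp

/-- The loop `v x ↦ g_w⁻¹ g_m`, where `v` exchanges the prefix `m` of `x` for `w`. -/
noncomputable def cocycleLoop (g₀ g₁ : Γ) (v : thompsonV) : LoopGroup Γ where
  toFun y := wordCocycle g₀ g₁ v (v⁻¹ • y)
  isLocallyConstant := by
    refine IsLocallyConstant.comp_continuous (g := wordCocycle g₀ g₁ v) ?_
      (continuous_const_smul v⁻¹)
    rw [IsLocallyConstant.iff_exists_open]
    intro x
    obtain ⟨⟨m, w⟩, hx, h⟩ := exists_adapted v x
    exact ⟨sdi m, isOpen_sdi m, hx, fun y hy => by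
      rw [wordCocycle_eq g₀ g₁ v hy h, wordCocycle_eq g₀ g₁ v hx h]⟩

lemma cocycleLoop_smul (g₀ g₁ : Γ) (v : thompsonV) (x : Cantor) :
    cocycleLoop g₀ g₁ v (v • x) = wordCocycle g₀ g₁ v x := by
  change wordCocycle g₀ g₁ v (v⁻¹ • v • x) = _
  rw [inv_smul_smul]

lemma tau_one_one (v : thompsonV) (x : Cantor) : tau (1 : MulAut Γ) 1 v x = 1 := by
  have h : ∀ m, wordAut (1 : MulAut Γ) 1 m = 1 := by
    intro m
    induction m with
    | nil => rfl
    | cons b m ih => cases b <;> simp [wordAut, ih]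
  obtain ⟨⟨m, w⟩, hx, hv⟩ := exists_adapted v x
  rw [tau_eq _ _ v hx hv, h, h, inv_one, mul_one]

/-- For inner twists τ is conjugation by g_w⁻¹ g_m, so the two actions differ by conjugation by
`cocycleLoop`. With its cocycle identity this makes `untwist` multiplicative. -/
lemma jonesAction_conj (g₀ g₁ : Γ) (v : thompsonV) (a : LoopGroup Γ) :
    jonesAction (MulAut.conj g₀) (MulAut.conj g₁) v a * cocycleLoop g₀ g₁ v =
      cocycleLoop g₀ g₁ v * jonesAction 1 1 v a := by
  ext y
  obtain ⟨x, rfl⟩ := MulAction.surjective v y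
  rw [LocallyConstant.mul_apply, LocallyConstant.mul_apply, jonesAction_apply,
    jonesAction_apply, tau_conj, tau_one_one, cocycleLoop_smul]
  simp

lemma cocycleLoop_mul (g₀ g₁ : Γ) (v w : thompsonV) :
    cocycleLoop g₀ g₁ (v * w) = cocycleLoop g₀ g₁ v * jonesAction 1 1 v (cocycleLoop g₀ g₁ w) := by
  ext y
  obtain ⟨x, rfl⟩ := MulAction.surjective (v * w) y
  beta_reduce
  rw [LocallyConstant.mul_apply, cocycleLoop_smul, wordCocycle_mul, mul_smul, cocycleLoop_smul,
    jonesAction_apply, tau_one_one, cocycleLoop_smul]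
  rfl

/-- Twisting by inner automorphisms does not change the fraction group. -/
noncomputable def untwist (g₀ g₁ : Γ) :
    FractionGroup (MulAut.conj g₀) (MulAut.conj g₁) ≃* FractionGroup (1 : MulAut Γ) 1 where
  toFun x := ⟨x.left * cocycleLoop g₀ g₁ x.right, x.right⟩
  invFun x := ⟨x.left * (cocycleLoop g₀ g₁ x.right)⁻¹, x.right⟩
  left_inv x := by ext1 <;> simp
  right_inv x := by ext1 <;> simp
  map_mul' x y := by
    ext1
    · simp only [mul_left, mul_right, cocycleLoop_mul, map_mul]
      rw [mul_assoc, ← mul_assoc (jonesAction _ _ x.right y.left), jonesAction_conj]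
      simp only [mul_assoc]
    · rfl

/-- The untwisted fraction group is functorial in the coefficient group. -/
noncomputable def fractionGroupCongr {Δ : Type*} [Group Δ] (f : Γ ≃* Δ) :
    FractionGroup (1 : MulAut Γ) 1 ≃* FractionGroup (1 : MulAut Δ) 1 :=
  SemidirectProduct.congr
    { toFun := LocallyConstant.map f
      invFun := LocallyConstant.map f.symm
      left_inv := fun a => by ext x; simp
      right_inv := fun a => by ext x; simp
      map_mul' := fun a b => by ext x; simp [LocallyConstant.mul_apply] }
    (MulEquiv.refl _) fun v => by
      ext a y
      obtain ⟨x, rfl⟩ := MulAction.surjective v y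
      change f (jonesAction 1 1 v a (v • x)) =
        jonesAction 1 1 v (LocallyConstant.map f a) (v • x)
      rw [jonesAction_apply, jonesAction_apply, tau_one_one, tau_one_one]
      rfl

end Inner

/-! ### Classification of fraction groups with inner twists -/

theorem nonempty_mulEquiv_iff {Γ Δ : Type*} [Group Γ] [Group Δ] (α₀ α₁ : MulAut Γ)
    {β₀ β₁ : MulAut Δ} (h₀ : IsInner β₀) (h₁ : IsInner β₁) :
    Nonempty (FractionGroup α₀ α₁ ≃* FractionGroup β₀ β₁) ↔
      Nonempty (Γ ≃* Δ) ∧ IsInner α₀ ∧ IsInner α₁ := by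
  constructor
  · rintro ⟨θ⟩
    obtain ⟨T, -⟩ := exists_loopIso θ
    exact ⟨⟨T.localIso fun _ => true⟩, isInner_of_mulEquiv_fractionGroup θ h₀ h₁⟩
  · rintro ⟨⟨f⟩, ⟨a₀, rfl⟩, ⟨a₁, rfl⟩⟩
    obtain ⟨b₀, rfl⟩ := h₀
    obtain ⟨b₁, rfl⟩ := h₁
    exact ⟨((untwist a₀ a₁).trans (fractionGroupCongr f)).trans (untwist b₀ b₁).symm⟩

end DiscreteLoop

theorem theoremA {Γ : Type*} {Γ' : Type*} [Group Γ] [Group Γ']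
    (α₀ α₁ : MulAut Γ) (β₀ β₁ : MulAut Γ') :
    (Nonempty (DiscreteLoop.FractionGroup α₀ α₁ ≃* DiscreteLoop.FractionGroup β₀ β₁) →
      Nonempty (Γ ≃* Γ')) ∧
    (DiscreteLoop.IsInner β₀ → DiscreteLoop.IsInner β₁ →
      (Nonempty (DiscreteLoop.FractionGroup α₀ α₁ ≃* DiscreteLoop.FractionGroup β₀ β₁) ↔
        Nonempty (Γ ≃* Γ') ∧ DiscreteLoop.IsInner α₀ ∧ DiscreteLoop.IsInner α₁)) ∧
    (Nonempty (DiscreteLoop.FractionGroup (1 : MulAut Γ) 1 ≃*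
        DiscreteLoop.FractionGroup (1 : MulAut Γ') 1) ↔
      Nonempty (Γ ≃* Γ')) := by
  refine ⟨?_, fun h₀ h₁ => DiscreteLoop.nonempty_mulEquiv_iff α₀ α₁ h₀ h₁, ?_⟩
  · rintro ⟨θ⟩
    obtain ⟨T, -⟩ := DiscreteLoop.exists_loopIso θ
    exact ⟨T.localIso fun _ => true⟩
  · have h1 : DiscreteLoop.IsInner (1 : MulAut Γ) := ⟨1, (map_one _).symm⟩
    have h1' : DiscreteLoop.IsInner (1 : MulAut Γ') := ⟨1, (map_one _).symm⟩
    rw [DiscreteLoop.nonempty_mulEquiv_iff 1 1 h1' h1']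
    exact ⟨fun h => h.1, fun h => ⟨h, h1, h1⟩⟩
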